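/- **Setting.** For an open set $\Omega\subset\mathbb R^3$, $q\in\mathbb N_0$ and $\beta\in[0,1]$, let $$\|f\|_{C^{q,\beta}(\Omega)}=\sum_{j\le q}\sup_{\Omega}|D^jf|+\sup_{x,y\in\Omega,\,x\ne y}\frac{|D^qf(x)-D^qf(y)|}{|x-y|^{\beta}} .$$ $C^{q,\beta}(\overline\Omega)$ is the set of functions that are $C^q$ in $\Omega$, whose derivatives of order $\le q$ extend continuously to $\overline\Omega$, and whose $C^{q,\beta}(\Omega)$-norm is finite; $C^{q,\beta}_0(\Omega)$ is the set of functions of class $C^{q,\beta}$ with compact support in $\Omega$. Let $\alpha\in(0,1)$, let $\Omega_0\subset\mathbb R^3$ be a bounded domain of class $C^{4,\alpha}$, let $B=\overline{B_r(z)}\subset\Omega_0$ with $r>0$, and put $\Omega_b=\Omega_0\setminus B$. For a ball $\Omega^{ext}=B_R(z)$ containing $\overline{\Omega_b}$ and a constant $K\ge0$, let $U^{ad}$ be the set of all bijections $\Phi$ of $\overline{\Omega^{ext}}$ onto itself with $\Phi,\Phi^{-1}\in[C^{4,\alpha}(\overline{\Omega^{ext}})]^3$ and $\|\Phi\|_{[C^{4,\alpha}(\Omega^{ext})]^3}\le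 K$, $\|\Phi^{-1}\|_{[C^{4,\alpha}(\Omega^{ext})]^3}\le K$. The $C^{4,\alpha}$-admissible shapes are the sets $\Omega=\Phi(\Omega_b)$ with $\Phi\in U^{ad}$. **Lemma (uniform extension).** Fix $\alpha,\Omega_0,z,r,K$ as above, $q\in\mathbb N_0$ and $\delta>0$. There is a constant $C_q>0$ such that the following holds for every ball $\Omega^{ext}=B_R(z)$ that contains the $\delta$-neighbourhood of $\Omega_b$, every $\beta\in[0,1]$ with $1\le q+\beta\le 4+\alpha$, every $C^{4,\alpha}$-admissible shape $\Omega$, and every real-valued $v\in C^{q,\beta}(\overline\Omega)$: there is a function $w\in C^{q,\beta}_0(\Omega^{ext})$ with $w=v$ on $\overline\Omega$ and $$\|w\|_{C^{q,\beta}(\Omega^{ext})}\le C_q\,\|v\|_{C^{q,\beta}(\Omega)} .$$ In particular, $C_q$ does not depend on $\Omega$, and it depends on $\Omega^{ext}$ at most through the lower bound $\delta$ on the margin between $\Omega_b$ and $\partial\Omega^{ext}$. -/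

import Mathlib

open Set Metric
open scoped NNReal ENNReal

/-- Three-dimensional Euclidean space. -/
abbrev E3 : Type := EuclideanSpace ℝ (Fin 3)

section Holder

variable {E F : Type*} [NormedAddCommGroup E] [NormedSpace ℝ E]
  [NormedAddCommGroup F] [NormedSpace ℝ F]

/-- The `C^{q,β}` norm of `f` on an open set `Ω`, with values in `[0,∞]`: the sum over `j ≤ q` of
`sup_Ω ‖D^j f‖`, plus the `β`-Hölder seminorm on `Ω` of the derivative `D^q f`. -/
noncomputable def holderNorm (q : ℕ) (β : ℝ≥0) (Ω : Set E) (f : E → F) : ℝ≥0∞ :=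
  (∑ j ∈ Finset.range (q + 1), ⨆ x ∈ Ω, ‖iteratedFDeriv ℝ j f x‖ₑ)
    + eHolderNorm β (fun x : Ω => iteratedFDeriv ℝ q f x)

/-- `f` belongs to `C^{q,β}` of the closure of the open set `Ω`: it is `C^q` in `Ω`, it is
continuous on the closure, its derivatives of order at most `q` extend continuously to the closure,
and its `C^{q,β}` norm is finite. Only the values of `f` on the closure matter. -/
structure InHolder (q : ℕ) (β : ℝ≥0) (Ω : Set E) (f : E → F) : Prop where
  contDiffOn : ContDiffOn ℝ (q : WithTop ℕ∞) f Ω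
  continuousOn : ContinuousOn f (closure Ω)
  extend : ∀ j ≤ q, ∃ g : E → ContinuousMultilinearMap ℝ (fun _ : Fin j => E) F,
    ContinuousOn g (closure Ω) ∧ EqOn g (iteratedFDeriv ℝ j f) Ω
  norm_lt_top : holderNorm q β Ω f < ⊤

/-- `f` belongs to `C^{q,β}_0(Ω)`: it is of class `C^{q,β}` and has compact support inside the
open set `Ω` (it is extended by zero outside `Ω`). -/
structure InHolderZero (q : ℕ) (β : ℝ≥0) (Ω : Set E) (f : E → F) : Prop where
  inHolder : InHolder q β Ω f
  hasCompactSupport : HasCompactSupport f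
  tsupport_subset : tsupport f ⊆ Ω

end Holder

/-- Bounded domains of class `C^{k,α}` in `ℝ³`: near each boundary point there is a
`C^{k,α}`-diffeomorphism `ψ` (with inverse `χ`) of a ball onto an open set, which maps the part of
the ball in `Ω` into the open upper half-space and the part in `∂Ω` into the bounding plane. -/
structure IsHolderDomain (k : ℕ) (α : ℝ≥0) (Ω : Set E3) : Prop where
  isOpen : IsOpen Ω
  isConnected : IsConnected Ω
  isBounded : Bornology.IsBounded Ω
  chart : ∀ x₀ ∈ frontier Ω, ∃ ρ : ℝ, 0 < ρ ∧ ∃ ψ χ : E3 → E3,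
    IsOpen (ψ '' ball x₀ ρ) ∧ LeftInvOn χ ψ (ball x₀ ρ) ∧
    (∀ x ∈ ball x₀ ρ ∩ Ω, 0 < ψ x 2) ∧
    (∀ x ∈ ball x₀ ρ ∩ frontier Ω, ψ x 2 = 0) ∧
    InHolder k α (ball x₀ ρ) ψ ∧ InHolder k α (ψ '' ball x₀ ρ) χ

/-- The design variables: bijections `Φ` of the closure of `Ωext` onto itself such that `Φ` and its
inverse are of class `C^{k,α}` up to the boundary, with `C^{k,α}` norms at most `K`. -/
def designVariables (k : ℕ) (α K : ℝ≥0) (Ωext : Set E3) : Set (E3 → E3) :=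
  {Φ | BijOn Φ (closure Ωext) (closure Ωext) ∧
    InHolder k α Ωext Φ ∧ holderNorm k α Ωext Φ ≤ K ∧
    ∃ Ψ : E3 → E3, InvOn Ψ Φ (closure Ωext) (closure Ωext) ∧
      InHolder k α Ωext Ψ ∧ holderNorm k α Ωext Ψ ≤ K}

/-- The basic design: a domain from which a closed ball has been removed. -/
def basicDesign (Ω₀ : Set E3) (z : E3) (r : ℝ) : Set E3 :=
  Ω₀ \ closedBall z r

/-- The admissible shapes: images of the baseline shape `Ωb` under the design variables. -/
def admissibleShapes (k : ℕ) (α K : ℝ≥0) (Ωb Ωext : Set E3) : Set (Set E3) :=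
  {Ω | ∃ Φ ∈ designVariables k α K Ωext, Ω = Φ '' Ωb}

-- Everything is transported to the fixed baseline shape `D = basicDesign Ω₀ z r`. There `v ∘ Φ` is
-- extended with a constant depending only on `D`, `K`, `α`, `q`, `δ`; the extension is composed
-- with `Φ⁻¹` and set to zero outside the ball.
--
-- The obstacle is that `Ω` and `D` are not convex. A `C^{q,β}` bound does not directly make the
-- lower derivatives Lipschitz there with a uniform constant, so the product and chain rules cannot
-- be iterated on them. Composition, however, needs convexity only of the innermost domain
-- (`HolderBound.exists_comp`). Hence `v ∘ Φ` is never estimated on `D` itself; it is recorded as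
-- `TameOn`, meaning that its compositions with `C^{4,α}` maps from convex sets into `D` are
-- controlled (`exists_tameOn_comp`). Inverse boundary charts on half balls are such maps.
--
-- Near a boundary point the domain is flattened: by the given charts on `∂Ω₀`, and by an inversion
-- on the removed sphere. The half ball is then crossed by a higher-order reflection with five
-- dilations, exact up to order four (`ReflectionData.exists_holderBound_ext`). This gives
-- `LocallyExtendable` at every point of `closure D`, and compactness together with cutoffs glues
-- the local extensions (`exists_extension_of_locallyExtendable`).
--
-- The extension on `D` is supported within distance `δ/2` of `D`, a compact subset of the ball.
-- Since `Φ` maps the open ball into itself (`mapsTo_ball_of_leftInvOn`), the support stays compact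
-- in the ball after transport. The radius `R` enters no estimate, because balls are convex whatever
-- their size.

universe u

/-! ### Calculus of quantitative Hölder bounds: lowering, products, composition. -/

section HolderBound

variable {E F G H : Type u} [NormedAddCommGroup E] [NormedSpace ℝ E]
  [NormedAddCommGroup F] [NormedSpace ℝ F] [NormedAddCommGroup G] [NormedSpace ℝ G]
  [NormedAddCommGroup H] [NormedSpace ℝ H]

/-- Quantitative `C^{q,β}` regularity on a set: all derivatives of order at most `q` are bounded
by `M`, and the top one is uniformly continuous and `β`-Hölder with constant `M`. -/
structure HolderBound (q : ℕ) (β : ℝ) (U : Set E) (f : E → F) (M : ℝ) : Prop where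
  nonneg : 0 ≤ M
  contDiffOn : ContDiffOn ℝ (q : WithTop ℕ∞) f U
  norm_le : ∀ j ≤ q, ∀ x ∈ U, ‖iteratedFDeriv ℝ j f x‖ ≤ M
  holder : ∀ x ∈ U, ∀ y ∈ U,
    ‖iteratedFDeriv ℝ q f x - iteratedFDeriv ℝ q f y‖ ≤ M * ‖x - y‖ ^ β
  unifCont : UniformContinuousOn (iteratedFDeriv ℝ q f) U

/-- Uniform continuity of the top derivative is carried along separately because the Hölder estimate
gives none when `β = 0`, while the reflection needs boundary values of all derivatives. -/
theorem uniformContinuousOn_of_norm_sub_le {X F₁ F₂ F₃ : Type*} [PseudoMetricSpace X]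
    [SeminormedAddCommGroup F₁] [SeminormedAddCommGroup F₂] [SeminormedAddCommGroup F₃]
    {U : Set X} {f : X → F₁} {g : X → F₂} {h : X → F₃} (A : ℝ)
    (hf : UniformContinuousOn f U) (hg : UniformContinuousOn g U)
    (hle : ∀ x ∈ U, ∀ y ∈ U, ‖h x - h y‖ ≤ A * (‖f x - f y‖ + ‖g x - g y‖)) :
    UniformContinuousOn h U := by
  rw [Metric.uniformContinuousOn_iff] at hf hg ⊢
  intro ε hε
  have hA : 0 < |A| + 1 := by positivity
  obtain ⟨d₁, hd₁, h₁⟩ := hf (ε / (2 * (|A| + 1))) (by positivity)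
  obtain ⟨d₂, hd₂, h₂⟩ := hg (ε / (2 * (|A| + 1))) (by positivity)
  refine ⟨min d₁ d₂, lt_min hd₁ hd₂, fun x hx y hy hxy => ?_⟩
  have k₁ := h₁ x hx y hy (hxy.trans_le (min_le_left _ _))
  have k₂ := h₂ x hx y hy (hxy.trans_le (min_le_right _ _))
  rw [dist_eq_norm] at k₁ k₂ ⊢
  have hs : 0 ≤ ‖f x - f y‖ + ‖g x - g y‖ := by positivity
  calc ‖h x - h y‖ ≤ A * (‖f x - f y‖ + ‖g x - g y‖) := hle x hx y hy
    _ ≤ (|A| + 1) * (‖f x - f y‖ + ‖g x - g y‖) := by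
        gcongr; linarith [le_abs_self A]
    _ < (|A| + 1) * (ε / (2 * (|A| + 1)) + ε / (2 * (|A| + 1))) := by gcongr
    _ = ε := by field_simp; ring

theorem uniformContinuousOn_of_norm_sub_le_norm {X F₁ F₃ : Type*} [PseudoMetricSpace X]
    [SeminormedAddCommGroup F₁] [SeminormedAddCommGroup F₃]
    {U : Set X} {f : X → F₁} {h : X → F₃} (A : ℝ) (hf : UniformContinuousOn f U)
    (hle : ∀ x ∈ U, ∀ y ∈ U, ‖h x - h y‖ ≤ A * ‖f x - f y‖) :
    UniformContinuousOn h U := by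
  refine uniformContinuousOn_of_norm_sub_le |A| hf hf fun x hx y hy => (hle x hx y hy).trans ?_
  have := norm_nonneg (f x - f y)
  nlinarith [le_abs_self A, abs_nonneg A]

namespace HolderBound

variable {q : ℕ} {β γ : ℝ} {U V : Set E} {f g : E → F} {M N : ℝ}

theorem zero_iff : HolderBound 0 β U f M ↔
    0 ≤ M ∧ (∀ x ∈ U, ‖f x‖ ≤ M) ∧ (∀ x ∈ U, ∀ y ∈ U, ‖f x - f y‖ ≤ M * ‖x - y‖ ^ β) ∧
      UniformContinuousOn f U := by
  have key : ∀ x y : E, ‖iteratedFDeriv ℝ 0 f x - iteratedFDeriv ℝ 0 f y‖ = ‖f x - f y‖ := by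
    intro x y
    simp only [iteratedFDeriv_zero_eq_comp, Function.comp_apply]
    rw [← map_sub, LinearIsometryEquiv.norm_map]
  constructor
  · intro h
    refine ⟨h.nonneg, fun x hx => ?_, fun x hx y hy => ?_, ?_⟩
    · simpa using h.norm_le 0 le_rfl x hx
    · simpa [key] using h.holder x hx y hy
    · exact uniformContinuousOn_of_norm_sub_le_norm 1 h.unifCont
        fun x _ y _ => by rw [key, one_mul]
  · rintro ⟨h0, h1, h2, h3⟩
    refine ⟨h0, ?_, fun j hj x hx => ?_, fun x hx y hy => ?_, ?_⟩
    · rw [Nat.cast_zero]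
      exact contDiffOn_zero.2 h3.continuousOn
    · obtain rfl : j = 0 := by omega
      simpa using h1 x hx
    · simpa [key] using h2 x hx y hy
    · exact uniformContinuousOn_of_norm_sub_le_norm 1 h3
        fun x _ y _ => by rw [key, one_mul]

/-- The engine of every induction on `q` below: the target `F` is replaced by `E →L[ℝ] F`, which is
why the inductions generalize over `F` and all spaces share one universe. -/
theorem succ_iff (hU : IsOpen U) : HolderBound (q + 1) β U f M ↔
    DifferentiableOn ℝ f U ∧ (∀ x ∈ U, ‖f x‖ ≤ M) ∧ HolderBound q β U (fderiv ℝ f) M := by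
  have key : ∀ x y : E, ‖iteratedFDeriv ℝ (q + 1) f x - iteratedFDeriv ℝ (q + 1) f y‖ =
      ‖iteratedFDeriv ℝ q (fderiv ℝ f) x - iteratedFDeriv ℝ q (fderiv ℝ f) y‖ := by
    intro x y
    rw [iteratedFDeriv_succ_eq_comp_right, iteratedFDeriv_succ_eq_comp_right, ← dist_eq_norm,
      ← dist_eq_norm]
    exact LinearIsometryEquiv.dist_map _ _ _
  have hcd : ContDiffOn ℝ ((q + 1 : ℕ) : WithTop ℕ∞) f U ↔ DifferentiableOn ℝ f U ∧
      ContDiffOn ℝ (q : WithTop ℕ∞) (fderiv ℝ f) U := by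
    push_cast
    rw [contDiffOn_succ_iff_fderiv_of_isOpen hU]
    simp
  constructor
  · intro h
    refine ⟨(hcd.1 h.contDiffOn).1, fun x hx => by simpa using h.norm_le 0 (by omega) x hx,
      h.nonneg, (hcd.1 h.contDiffOn).2, fun j hj x hx => ?_, fun x hx y hy => ?_, ?_⟩
    · rw [norm_iteratedFDeriv_fderiv]
      exact h.norm_le (j + 1) (by omega) x hx
    · rw [← key]
      exact h.holder x hx y hy
    · exact uniformContinuousOn_of_norm_sub_le_norm 1 h.unifCont
        fun x _ y _ => by rw [key, one_mul]
  · rintro ⟨h0, h1, h2⟩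
    refine ⟨h2.nonneg, hcd.2 ⟨h0, h2.contDiffOn⟩, fun j hj x hx => ?_, fun x hx y hy => ?_, ?_⟩
    · cases j with
      | zero => simpa using h1 x hx
      | succ j =>
        rw [← norm_iteratedFDeriv_fderiv]
        exact h2.norm_le j (by omega) x hx
    · rw [key]
      exact h2.holder x hx y hy
    · exact uniformContinuousOn_of_norm_sub_le_norm 1 h2.unifCont
        fun x _ y _ => by rw [key, one_mul]

theorem norm_apply_le (h : HolderBound q β U f M) : ∀ x ∈ U, ‖f x‖ ≤ M :=
  fun x hx => by simpa using h.norm_le 0 (Nat.zero_le _) x hx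

theorem mono (h : HolderBound q β U f M) (hV : V ⊆ U) (hM : M ≤ N) :
    HolderBound q β V f N where
  nonneg := h.nonneg.trans hM
  contDiffOn := h.contDiffOn.mono hV
  norm_le j hj x hx := (h.norm_le j hj x (hV hx)).trans hM
  holder x hx y hy := (h.holder x (hV hx) y (hV hy)).trans (by gcongr)
  unifCont := h.unifCont.mono hV

theorem congr (hU : IsOpen U) (h : HolderBound q β U f M) (hfg : EqOn g f U) :
    HolderBound q β U g M := by
  have key : ∀ j, EqOn (iteratedFDeriv ℝ j g) (iteratedFDeriv ℝ j f) U := fun j x hx =>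
    ((hfg.eventuallyEq_of_mem (hU.mem_nhds hx)).iteratedFDeriv ℝ j).eq_of_nhds
  refine ⟨h.nonneg, h.contDiffOn.congr hfg, fun j hj x hx => ?_, fun x hx y hy => ?_,
    h.unifCont.congr fun x hx => (key q hx).symm⟩
  · rw [key j hx]
    exact h.norm_le j hj x hx
  · rw [key q hx, key q hy]
    exact h.holder x hx y hy

theorem rpow_le_of_bound {a β γ s t : ℝ} (hβ : 0 ≤ β) (hβγ : β ≤ γ) (ha : 0 ≤ a) (ht : 0 ≤ t)
    (h₁ : s ≤ a * t ^ γ) (h₂ : s ≤ 2 * a) : s ≤ 2 * a * t ^ β := by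
  rcases le_total t 1 with h | h
  · rcases ht.eq_or_lt with rfl | ht0
    · rcases hβ.eq_or_lt with rfl | hβ0
      · simpa using h₂
      · rw [Real.zero_rpow (by linarith)] at h₁
        rw [Real.zero_rpow hβ0.ne']
        linarith
    · have := Real.rpow_le_rpow_of_exponent_ge ht0 h hβγ
      have h3 : 0 ≤ t ^ β := by positivity
      nlinarith
  · have := Real.one_le_rpow h hβ
    nlinarith

theorem lower_exp (h : HolderBound q γ U f M) (hβ : 0 ≤ β) (hβγ : β ≤ γ) :
    HolderBound q β U f (2 * M) where
  nonneg := by linarith [h.nonneg]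
  contDiffOn := h.contDiffOn
  norm_le j hj x hx := (h.norm_le j hj x hx).trans (by linarith [h.nonneg])
  holder x hx y hy := by
    refine rpow_le_of_bound hβ hβγ h.nonneg (norm_nonneg _) (h.holder x hx y hy) ?_
    have := norm_sub_le (iteratedFDeriv ℝ q f x) (iteratedFDeriv ℝ q f y)
    linarith [h.norm_le q le_rfl x hx, h.norm_le q le_rfl y hy]
  unifCont := h.unifCont

theorem lipschitz (hU : IsOpen U) (hc : Convex ℝ U) (h : HolderBound (q + 1) β U f M) :
    ∀ x ∈ U, ∀ y ∈ U, ‖f x - f y‖ ≤ M * ‖x - y‖ := by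
  intro x hx y hy
  obtain ⟨h0, -, h2⟩ := (succ_iff hU).1 h
  exact hc.norm_image_sub_le_of_norm_fderiv_le
    (fun z hz => (h0 z hz).differentiableAt (hU.mem_nhds hz)) h2.norm_apply_le hy hx

/-- Convexity turns the derivative bound into a Lipschitz bound; interpolating it with the
oscillation bound `2 * M` gives every exponent in `[0,1]` with a constant free of `β`. -/
theorem lower (hU : IsOpen U) (hc : Convex ℝ U) (hβ : 0 ≤ β) (hβ1 : β ≤ 1)
    (h : HolderBound (q + 1) γ U f M) : HolderBound q β U f (2 * M) := by
  induction q generalizing F with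
  | zero =>
    have hL := h.lipschitz hU hc
    have hM := h.nonneg
    refine zero_iff.2 ⟨by linarith, fun x hx => (h.norm_apply_le x hx).trans (by linarith),
      fun x hx y hy => ?_,
      uniformContinuousOn_of_norm_sub_le_norm M uniformContinuous_id.uniformContinuousOn hL⟩
    refine rpow_le_of_bound hβ hβ1 hM (norm_nonneg _) (by simpa using hL x hx y hy) ?_
    linarith [norm_sub_le (f x) (f y), h.norm_apply_le x hx, h.norm_apply_le y hy]
  | succ q ih =>
    obtain ⟨h0, h1, h2⟩ := (succ_iff hU).1 h
    exact (succ_iff hU).2 ⟨h0, fun x hx => (h1 x hx).trans (by linarith [h.nonneg]), ih h2⟩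

/-- Lowering both parameters of the regularity class `C^{p,γ}`. -/
theorem lower_of_le {p : ℕ} (hU : IsOpen U) (hc : Convex ℝ U) (hβ : 0 ≤ β) (hβ1 : β ≤ 1)
    (hγ : γ < 1) (hle : q + β ≤ p + γ) (h : HolderBound p γ U f M) :
    HolderBound q β U f (2 ^ (p + 1) * M) := by
  induction p generalizing γ M with
  | zero =>
    obtain rfl : q = 0 := by
      have : (q : ℝ) < 1 := by push_cast at hle; linarith
      exact Nat.lt_one_iff.1 (by exact_mod_cast this)
    simpa using h.lower_exp hβ (by simpa using hle)
  | succ p ih =>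
    have hM := h.nonneg
    have h2 : (1 : ℝ) ≤ 2 ^ (p + 1) := one_le_pow₀ (by norm_num)
    rcases lt_trichotomy q (p + 1) with hq | rfl | hq
    · rcases eq_or_lt_of_le (Nat.lt_succ_iff.1 hq) with rfl | hq
      · exact (h.lower hU hc hβ hβ1).mono subset_rfl (by rw [pow_succ]; nlinarith)
      · have hq' : (q : ℝ) + 1 ≤ p := by exact_mod_cast hq
        -- One full order is dropped to reach `C^{p,0}`, which still dominates `q + β` because `q +
        -- 1 ≤ p` and `β ≤ 1`.
        refine (ih (γ := 0) (by norm_num) (by linarith)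
          (h.lower hU hc le_rfl (by norm_num))).mono subset_rfl ?_
        rw [pow_succ 2 (p + 1)]; linarith
    · exact (h.lower_exp hβ (by simpa using hle)).mono subset_rfl (by rw [pow_succ]; nlinarith)
    -- Impossible case: `q + β ≤ p + 1 + γ` with `γ < 1` excludes `q ≥ p + 2`.
    · have : (p : ℝ) + 1 + 1 ≤ q := by exact_mod_cast hq
      push_cast at hle
      linarith

theorem add (hU : IsOpen U) (hf : HolderBound q β U f M) (hg : HolderBound q β U g N) :
    HolderBound q β U (f + g) (M + N) := by
  have key : ∀ j ≤ q, ∀ x ∈ U, iteratedFDeriv ℝ j (f + g) x =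
      iteratedFDeriv ℝ j f x + iteratedFDeriv ℝ j g x := fun j hj x hx =>
    iteratedFDeriv_add_apply
      ((hf.contDiffOn.contDiffAt (hU.mem_nhds hx)).of_le (by exact_mod_cast hj))
      ((hg.contDiffOn.contDiffAt (hU.mem_nhds hx)).of_le (by exact_mod_cast hj))
  have hle : ∀ x ∈ U, ∀ y ∈ U,
      ‖iteratedFDeriv ℝ q (f + g) x - iteratedFDeriv ℝ q (f + g) y‖ ≤
        ‖iteratedFDeriv ℝ q f x - iteratedFDeriv ℝ q f y‖ +
        ‖iteratedFDeriv ℝ q g x - iteratedFDeriv ℝ q g y‖ := fun x hx y hy => by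
    rw [key q le_rfl x hx, key q le_rfl y hy, add_sub_add_comm]
    exact norm_add_le _ _
  refine ⟨add_nonneg hf.nonneg hg.nonneg, hf.contDiffOn.add hg.contDiffOn, fun j hj x hx => ?_,
    fun x hx y hy => ?_, ?_⟩
  · rw [key j hj x hx]
    exact (norm_add_le _ _).trans (add_le_add (hf.norm_le j hj x hx) (hg.norm_le j hj x hx))
  · rw [add_mul]
    exact (hle x hx y hy).trans (add_le_add (hf.holder x hx y hy) (hg.holder x hx y hy))
  · exact uniformContinuousOn_of_norm_sub_le 1 hf.unifCont hg.unifCont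
      fun x hx y hy => by rw [one_mul]; exact hle x hx y hy

/-- Products of `C^{q,β}` functions on a convex open set. -/
theorem exists_bilinear (q : ℕ) (B : F →L[ℝ] G →L[ℝ] H) : ∃ C : ℝ, 0 ≤ C ∧
    ∀ (β : ℝ) (U : Set E) (f : E → F) (g : E → G) (M N : ℝ), 0 ≤ β → β ≤ 1 → IsOpen U →
      Convex ℝ U → HolderBound q β U f M → HolderBound q β U g N →
      HolderBound q β U (fun x => B (f x) (g x)) (C * (M * N)) := by
  induction q generalizing F G H with
  | zero =>
    refine ⟨2 * ‖B‖, by positivity, fun β U f g M N hβ hβ1 hU hc hf hg => ?_⟩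
    have hM := hf.nonneg
    have hN := hg.nonneg
    obtain ⟨-, f1, f2, f3⟩ := zero_iff.1 hf
    obtain ⟨-, g1, g2, g3⟩ := zero_iff.1 hg
    have hle : ∀ x ∈ U, ∀ y ∈ U, ‖B (f x) (g x) - B (f y) (g y)‖ ≤
        ‖B‖ * (M * ‖g x - g y‖) + ‖B‖ * (‖f x - f y‖ * N) := fun x hx y hy => by
      have e : B (f x) (g x) - B (f y) (g y) = B (f x) (g x - g y) + B (f x - f y) (g y) := by
        simp
      rw [e]
      refine (norm_add_le _ _).trans (add_le_add ?_ ?_)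
      · refine (B.le_opNorm₂ _ _).trans ?_
        rw [mul_assoc]
        gcongr
        exact f1 x hx
      · refine (B.le_opNorm₂ _ _).trans ?_
        rw [mul_assoc]
        gcongr
        exact g1 y hy
    refine zero_iff.2 ⟨by positivity, fun x hx => ?_, fun x hx y hy => ?_, ?_⟩
    · refine (B.le_opNorm₂ _ _).trans ?_
      have : ‖f x‖ * ‖g x‖ ≤ M * N := mul_le_mul (f1 x hx) (g1 x hx) (norm_nonneg _) hM
      have hB := norm_nonneg B
      nlinarith [mul_nonneg (norm_nonneg (f x)) (norm_nonneg (g x)), mul_nonneg hM hN]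
    · refine (hle x hx y hy).trans ?_
      have h1 := g2 x hx y hy
      have h2 := f2 x hx y hy
      calc _ ≤ ‖B‖ * (M * (N * ‖x - y‖ ^ β)) + ‖B‖ * ((M * ‖x - y‖ ^ β) * N) := by gcongr
        _ = _ := by ring
    · refine uniformContinuousOn_of_norm_sub_le (‖B‖ * (M + N)) f3 g3
        fun x hx y hy => (hle x hx y hy).trans ?_
      have h1 : 0 ≤ ‖B‖ * (M * ‖f x - f y‖) := by positivity
      have h2 : 0 ≤ ‖B‖ * (N * ‖g x - g y‖) := by positivity
      nlinarith
  | succ q ih =>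
    obtain ⟨C₁, hC₁, ih₁⟩ := ih (B.precompR E)
    obtain ⟨C₂, hC₂, ih₂⟩ := ih (B.precompL E)
    refine ⟨‖B‖ + 2 * C₁ + 2 * C₂, by positivity, fun β U f g M N hβ hβ1 hU hc hf hg => ?_⟩
    have hM := hf.nonneg
    have hN := hg.nonneg
    obtain ⟨f0, f1, f2⟩ := (succ_iff hU).1 hf
    obtain ⟨g0, g1, g2⟩ := (succ_iff hU).1 hg
    have hd : ∀ x ∈ U, HasFDerivAt (fun x => B (f x) (g x))
        (B.precompR E (f x) (fderiv ℝ g x) + B.precompL E (fderiv ℝ f x) (g x)) x :=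
      fun x hx => B.hasFDerivAt_of_bilinear
        ((f0 x hx).differentiableAt (hU.mem_nhds hx)).hasFDerivAt
        ((g0 x hx).differentiableAt (hU.mem_nhds hx)).hasFDerivAt
    have hMN : 0 ≤ M * N := mul_nonneg hM hN
    refine (succ_iff hU).2 ⟨fun x hx => (hd x hx).differentiableAt.differentiableWithinAt,
      fun x hx => ?_, ?_⟩
    · refine (B.le_opNorm₂ _ _).trans ?_
      have : ‖f x‖ * ‖g x‖ ≤ M * N := mul_le_mul (f1 x hx) (g1 x hx) (norm_nonneg _) hM
      have h1 : ‖B‖ * (‖f x‖ * ‖g x‖) ≤ ‖B‖ * (M * N) := by gcongr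
      nlinarith [mul_nonneg hC₁ hMN, mul_nonneg hC₂ hMN]
    -- In the Leibniz rule the undifferentiated factor must be viewed in `C^{q,β}`; this is where
    -- convexity is used and where the factors 2 arise.
    · refine (HolderBound.add hU (ih₁ β U f (fderiv ℝ g) (2 * M) N hβ hβ1 hU hc
        (hf.lower hU hc hβ hβ1) g2) (ih₂ β U (fderiv ℝ f) g M (2 * N) hβ hβ1 hU hc f2
        (hg.lower hU hc hβ hβ1))).mono subset_rfl ?_ |>.congr hU fun x hx => (hd x hx).fderiv
      nlinarith [norm_nonneg B, mul_nonneg (norm_nonneg B) hMN]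

/-- Composition of `C^{q,β}` functions; only the inner domain has to be convex. -/
theorem exists_comp (q : ℕ) (N : ℝ) : ∃ C : ℝ, 0 ≤ C ∧
    ∀ (β : ℝ) (U : Set F) (V : Set E) (f : F → G) (g : E → F) (M : ℝ), 0 ≤ β → β ≤ 1 →
      IsOpen U → IsOpen V → Convex ℝ V → MapsTo g V U → HolderBound q β U f M →
      HolderBound q β V g N → (∀ x ∈ V, ∀ y ∈ V, ‖g x - g y‖ ≤ N * ‖x - y‖) →
      HolderBound q β V (f ∘ g) (C * M) := by
  induction q generalizing G N with
  | zero =>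
    refine ⟨1 + |N|, by positivity, fun β U V f g M hβ hβ1 hU hV hc hm hf hg hL => ?_⟩
    have hM := hf.nonneg
    have hN := hg.nonneg
    rw [abs_of_nonneg hN]
    obtain ⟨-, f1, f2, f3⟩ := zero_iff.1 hf
    refine zero_iff.2 ⟨by positivity, fun x hx => (f1 _ (hm hx)).trans (by nlinarith),
      fun x hx y hy => (f2 _ (hm hx) _ (hm hy)).trans ?_, ?_⟩
    · have h1 : ‖g x - g y‖ ^ β ≤ (N * ‖x - y‖) ^ β :=
        Real.rpow_le_rpow (norm_nonneg _) (hL x hx y hy) hβ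
      rw [Real.mul_rpow hN (norm_nonneg _)] at h1
      have h2 : N ^ β ≤ 1 + N := by
        rcases le_total N 1 with h | h
        · exact (Real.rpow_le_one hN h hβ).trans (by linarith)
        · have := Real.rpow_le_rpow_of_exponent_le h hβ1
          rw [Real.rpow_one] at this
          linarith
      have h3 : 0 ≤ ‖x - y‖ ^ β := by positivity
      calc M * ‖g x - g y‖ ^ β ≤ M * ((1 + N) * ‖x - y‖ ^ β) := by
            gcongr
            exact h1.trans (by gcongr)
        _ = _ := by ring
    · exact f3.comp (uniformContinuousOn_of_norm_sub_le_norm N uniformContinuous_id.uniformContinuousOn hL) hm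
  | succ q ih =>
    obtain ⟨C₁, hC₁, h₁⟩ := exists_bilinear (E := E) q (ContinuousLinearMap.compL ℝ E F G)
    -- The bound `2 * N` is the cost of lowering `g` by one order before composing it with `fderiv ℝ
    -- f`.
    obtain ⟨C₂, hC₂, h₂⟩ := ih (G := F →L[ℝ] G) (2 * N)
    refine ⟨1 + C₁ * (C₂ * |N|), by positivity,
      fun β U V f g M hβ hβ1 hU hV hc hm hf hg hL => ?_⟩
    have hM := hf.nonneg
    have hN := hg.nonneg
    rw [abs_of_nonneg hN]
    obtain ⟨f0, f1, f2⟩ := (succ_iff hU).1 hf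
    obtain ⟨g0, g1, g2⟩ := (succ_iff hV).1 hg
    have hd : ∀ x ∈ V, HasFDerivAt (f ∘ g) (ContinuousLinearMap.compL ℝ E F G
        ((fderiv ℝ f ∘ g) x) (fderiv ℝ g x)) x := fun x hx =>
      ((f0 _ (hm hx)).differentiableAt (hU.mem_nhds (hm hx))).hasFDerivAt.comp x
        ((g0 x hx).differentiableAt (hV.mem_nhds hx)).hasFDerivAt
    have hpos : 0 ≤ C₁ * (C₂ * N) * M := by positivity
    refine (succ_iff hV).2 ⟨fun x hx => (hd x hx).differentiableAt.differentiableWithinAt,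
      fun x hx => (f1 _ (hm hx)).trans (by nlinarith), ?_⟩
    have h3 := h₂ β U V (fderiv ℝ f) g M hβ hβ1 hU hV hc hm f2 (hg.lower hV hc hβ hβ1)
      fun x hx y hy => (hL x hx y hy).trans (by gcongr; linarith)
    refine (h₁ β V _ _ _ _ hβ hβ1 hV hc h3 g2).mono subset_rfl ?_ |>.congr hV
      fun x hx => (hd x hx).fderiv
    nlinarith

end HolderBound

end HolderBound

/-! ### Higher-order reflection across a hyperplane. -/

section Reflection

set_option linter.unusedSectionVars false

open Filter Topology

variable {E F : Type u} [NormedAddCommGroup E] [NormedSpace ℝ E]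
  [NormedAddCommGroup F] [NormedSpace ℝ F] {ι : Type*} [Fintype ι]

theorem UniformContinuousOn.exists_tendsto_nhdsWithin [CompleteSpace F] {S : Set E} {u : E → F}
    (hu : UniformContinuousOn u S) {x : E} (hx : x ∈ closure S) :
    ∃ y, Tendsto u (𝓝[S] x) (𝓝 y) := by
  have := mem_closure_iff_nhdsWithin_neBot.1 hx
  have hc : Cauchy (𝓝[S] x) := cauchy_nhds.mono nhdsWithin_le_nhds
  obtain ⟨y, hy⟩ := CompleteSpace.complete (hc.map_of_le hu inf_le_right)
  exact ⟨y, hy⟩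

theorem extendFrom_eq_self {S : Set E} {u : E → F} (hu : ContinuousOn u S) {x : E} (hx : x ∈ S) :
    extendFrom S u x = u x :=
  extendFrom_eq (subset_closure hx) (hu x hx)

/-- A `C^{0,β}` function extends to the closure with the same bounds. -/
theorem HolderBound.extendFrom_closure [CompleteSpace F] {S : Set E} {u : E → F} {β M : ℝ}
    (hβ : 0 ≤ β) (hS : IsCompact (closure S)) (h : HolderBound 0 β S u M) :
    (∀ x ∈ closure S, ‖extendFrom S u x‖ ≤ M) ∧
    (∀ x ∈ closure S, ∀ y ∈ closure S,
      ‖extendFrom S u x - extendFrom S u y‖ ≤ M * ‖x - y‖ ^ β) ∧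
    UniformContinuousOn (extendFrom S u) (closure S) := by
  obtain ⟨-, h1, h2, h3⟩ := HolderBound.zero_iff.1 h
  have hlim : ∀ x ∈ closure S, Tendsto u (𝓝[S] x) (𝓝 (extendFrom S u x)) := fun x hx =>
    tendsto_extendFrom (h3.exists_tendsto_nhdsWithin hx)
  refine ⟨fun x hx => ?_, fun x hx y hy => ?_, hS.uniformContinuousOn_of_continuous
    (continuousOn_extendFrom subset_rfl fun x hx =>
      h3.exists_tendsto_nhdsWithin hx)⟩
  · have := mem_closure_iff_nhdsWithin_neBot.1 hx
    exact le_of_tendsto (hlim x hx).norm (eventually_mem_nhdsWithin.mono h1)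
  · have := mem_closure_iff_nhdsWithin_neBot.1 hx
    have := mem_closure_iff_nhdsWithin_neBot.1 hy
    have l1 : Tendsto (fun p : E × E => ‖u p.1 - u p.2‖) (𝓝[S] x ×ˢ 𝓝[S] y)
        (𝓝 ‖extendFrom S u x - extendFrom S u y‖) :=
      (((hlim x hx).comp tendsto_fst).sub ((hlim y hy).comp tendsto_snd)).norm
    have l2 : Tendsto (fun p : E × E => M * ‖p.1 - p.2‖ ^ β) (𝓝[S] x ×ˢ 𝓝[S] y)
        (𝓝 (M * ‖x - y‖ ^ β)) := by
      have hx' : Tendsto (fun p : E × E => p.1) (𝓝[S] x ×ˢ 𝓝[S] y) (𝓝 x) :=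
        (tendsto_id.mono_left nhdsWithin_le_nhds).comp tendsto_fst
      have hy' : Tendsto (fun p : E × E => p.2) (𝓝[S] x ×ˢ 𝓝[S] y) (𝓝 y) :=
        (tendsto_id.mono_left nhdsWithin_le_nhds).comp tendsto_snd
      exact (((Real.continuous_rpow_const hβ).tendsto _).comp (hx'.sub hy').norm).const_mul M
    refine le_of_tendsto_of_tendsto l1 l2 ?_
    have e1 : ∀ᶠ p : E × E in 𝓝[S] x ×ˢ 𝓝[S] y, p.1 ∈ S ∧ p.2 ∈ S :=
      eventually_mem_nhdsWithin.prod_mk eventually_mem_nhdsWithin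
    exact e1.mono fun p hp => h2 _ hp.1 _ hp.2

theorem mem_closure_inter_pos {O : Set E} (hO : IsOpen O) (ℓ : E →L[ℝ] ℝ) {e x : E}
    (he : ℓ e = 1) (hx : x ∈ O) (hℓ : 0 ≤ ℓ x) : x ∈ closure (O ∩ {y | 0 < ℓ y}) := by
  have ht : Tendsto (fun t : ℝ => x + t • e) (𝓝[>] 0) (𝓝 x) := by
    have : Continuous fun t : ℝ => x + t • e := by fun_prop
    simpa using (this.tendsto 0).mono_left nhdsWithin_le_nhds
  refine mem_closure_of_tendsto ht ?_
  filter_upwards [ht (hO.mem_nhds hx), self_mem_nhdsWithin] with t h1 h2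
  refine ⟨h1, ?_⟩
  have : 0 < t := h2
  simp only [mem_ofPred_eq, map_add, map_smul, he, smul_eq_mul, mul_one]
  linarith

/-- Data for a higher-order reflection across the hyperplane `ℓ = 0` near its point `c`:
the half-space direction `e`, the dilation factors `a` and the radius `s` of a half ball. -/
structure ReflectionData (E : Type u) [NormedAddCommGroup E] [NormedSpace ℝ E]
    (ι : Type*) where
  ℓ : E →L[ℝ] ℝ
  e : E
  a : ι → ℝ
  c : E
  s : ℝ
  apply_e : ℓ e = 1
  apply_c : ℓ c = 0
  a_pos : ∀ k, 0 < a k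

namespace ReflectionData

variable (S : ReflectionData E ι)

/-- The open half ball on the positive side. -/
def half : Set E := ball S.c S.s ∩ {x | 0 < S.ℓ x}

/-- The map which is the identity on the positive side and a dilated reflection on the other. -/
noncomputable def fold (k : ι) (x : E) : E := x + ((1 + S.a k) * max (-S.ℓ x) 0) • S.e

/-- The dilated reflection. -/
noncomputable def refl (k : ι) : E →L[ℝ] E :=
  ContinuousLinearMap.id ℝ E - (1 + S.a k) • S.ℓ.smulRight S.e

/-- A common Lipschitz constant of the folding maps. -/
noncomputable def lip : ℝ := 1 + (1 + ∑ k, S.a k) * (‖S.ℓ‖ * ‖S.e‖)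

/-- The ball on which the reflected function is defined. -/
def small : Set E := ball S.c (S.s / S.lip)

/-- The reflected function. -/
noncomputable def ext (Λ : ι → F →L[ℝ] F) (u : E → F) (x : E) : F :=
  ∑ k, Λ k (extendFrom S.half u (S.fold k x))

theorem one_le_lip : 1 ≤ S.lip := by
  have : 0 ≤ ∑ k, S.a k := Finset.sum_nonneg fun k _ => (S.a_pos k).le
  unfold lip
  have : 0 ≤ (1 + ∑ k, S.a k) * (‖S.ℓ‖ * ‖S.e‖) := by positivity
  linarith

theorem lip_pos : 0 < S.lip := zero_lt_one.trans_le S.one_le_lip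

theorem isOpen_half : IsOpen S.half :=
  isOpen_ball.inter (isOpen_lt continuous_const S.ℓ.continuous)

theorem convex_half : Convex ℝ S.half :=
  (convex_ball _ _).inter (convex_halfSpace_gt S.ℓ.isLinear 0)

theorem isOpen_small : IsOpen S.small := isOpen_ball

theorem isCompact_closure_half [FiniteDimensional ℝ E] : IsCompact (closure S.half) :=
  have := FiniteDimensional.proper_real E
  (isBounded_ball.subset inter_subset_left).isCompact_closure

theorem fold_of_nonneg {k : ι} {x : E} (hx : 0 ≤ S.ℓ x) : S.fold k x = x := by
  simp [fold, max_eq_right (neg_nonpos.2 hx)]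

theorem refl_apply (k : ι) (x : E) : S.refl k x = x - ((1 + S.a k) * S.ℓ x) • S.e := by
  simp [refl, smul_smul]

theorem fold_of_nonpos {k : ι} {x : E} (hx : S.ℓ x ≤ 0) : S.fold k x = S.refl k x := by
  rw [refl_apply, fold, max_eq_left (neg_nonneg.2 hx), mul_neg, neg_smul, sub_eq_add_neg]

theorem apply_refl (k : ι) (x : E) : S.ℓ (S.refl k x) = -(S.a k * S.ℓ x) := by
  rw [refl_apply, map_sub, map_smul, S.apply_e, smul_eq_mul]
  ring

theorem apply_fold_nonneg (k : ι) (x : E) : 0 ≤ S.ℓ (S.fold k x) := by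
  rcases le_total 0 (S.ℓ x) with h | h
  · rwa [S.fold_of_nonneg h]
  · rw [S.fold_of_nonpos h, apply_refl]
    nlinarith [S.a_pos k]

theorem norm_fold_sub_le (k : ι) (x y : E) : ‖S.fold k x - S.fold k y‖ ≤ S.lip * ‖x - y‖ := by
  have e1 : S.fold k x - S.fold k y =
      (x - y) + ((1 + S.a k) * (max (-S.ℓ x) 0 - max (-S.ℓ y) 0)) • S.e := by
    simp only [fold, mul_sub, sub_smul]
    abel
  have hk : S.a k ≤ ∑ k, S.a k :=
    Finset.single_le_sum (fun i _ => (S.a_pos i).le) (Finset.mem_univ k)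
  have hmax : |max (-S.ℓ x) 0 - max (-S.ℓ y) 0| ≤ ‖S.ℓ‖ * ‖x - y‖ := by
    refine (abs_max_sub_max_le_abs _ _ _).trans ?_
    rw [neg_sub_neg, ← map_sub, norm_sub_rev]
    exact S.ℓ.le_opNorm _
  rw [e1]
  refine (norm_add_le _ _).trans ?_
  rw [norm_smul, Real.norm_eq_abs, abs_mul, abs_of_pos (by linarith [S.a_pos k])]
  have h0 := S.a_pos k
  have h1 : 0 ≤ ∑ k, S.a k := h0.le.trans hk
  calc ‖x - y‖ + (1 + S.a k) * |max (-S.ℓ x) 0 - max (-S.ℓ y) 0| * ‖S.e‖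
      ≤ ‖x - y‖ + (1 + ∑ k, S.a k) * (‖S.ℓ‖ * ‖x - y‖) * ‖S.e‖ := by gcongr
    _ = S.lip * ‖x - y‖ := by unfold lip; ring

theorem fold_mem {k : ι} {x : E} (hx : x ∈ S.small) :
    S.fold k x ∈ ball S.c S.s := by
  have h1 : S.fold k S.c = S.c := S.fold_of_nonneg S.apply_c.ge
  have h2 := S.norm_fold_sub_le k x S.c
  rw [h1] at h2
  rw [small, mem_ball, dist_eq_norm, lt_div_iff₀ S.lip_pos] at hx
  rw [mem_ball, dist_eq_norm]
  linarith

theorem fold_mem_closure {k : ι} {x : E} (hx : x ∈ S.small) : S.fold k x ∈ closure S.half :=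
  mem_closure_inter_pos isOpen_ball S.ℓ S.apply_e (S.fold_mem hx) (S.apply_fold_nonneg k x)

theorem refl_mem_half {k : ι} {x : E} (hx : x ∈ S.small) (h : S.ℓ x < 0) :
    S.refl k x ∈ S.half := by
  refine ⟨S.fold_of_nonpos (k := k) h.le ▸ S.fold_mem hx, ?_⟩
  rw [mem_ofPred_eq, apply_refl]
  nlinarith [S.a_pos k]

theorem mem_half {x : E} (hx : x ∈ S.small) (h : 0 < S.ℓ x) : x ∈ S.half := by
  refine ⟨?_, h⟩
  by_cases hι : Nonempty ι
  · obtain ⟨k⟩ := hι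
    exact S.fold_of_nonneg (k := k) h.le ▸ S.fold_mem hx
  · have := not_nonempty_iff.1 hι
    rw [small, mem_ball, lt_div_iff₀ S.lip_pos] at hx
    rw [mem_ball]
    nlinarith [S.one_le_lip, dist_nonneg (x := x) (y := S.c)]

theorem ext_of_mem_half {Λ : ι → F →L[ℝ] F} (hΛ : ∑ k, Λ k = ContinuousLinearMap.id ℝ F)
    {u : E → F} (hu : ContinuousOn u S.half) {x : E} (hx : x ∈ S.half) : S.ext Λ u x = u x := by
  have h2 : ∑ k, Λ k (u x) = u x := by
    rw [← _root_.sum_apply, hΛ]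
    rfl
  rw [← h2]
  refine Finset.sum_congr rfl fun k _ => ?_
  rw [S.fold_of_nonneg (le_of_lt hx.2), extendFrom_eq_self hu hx]

theorem ext_of_neg {Λ : ι → F →L[ℝ] F} {u : E → F} (hu : ContinuousOn u S.half) {x : E}
    (hx : x ∈ S.small) (h : S.ℓ x < 0) : S.ext Λ u x = ∑ k, Λ k (u (S.refl k x)) :=
  Finset.sum_congr rfl fun k _ => by
    rw [S.fold_of_nonpos h.le, extendFrom_eq_self hu (S.refl_mem_half hx h)]

/-- The folding maps are Lipschitz on both sides at once, so at order zero no matching condition on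
`Λ` is needed. -/
theorem ext_zero [FiniteDimensional ℝ E] [CompleteSpace F] (Λ : ι → F →L[ℝ] F) {u : E → F}
    {β M : ℝ} (hβ : 0 ≤ β) (hβ1 : β ≤ 1) (h : HolderBound 0 β S.half u M) :
    HolderBound 0 β S.small (S.ext Λ u) ((∑ k, ‖Λ k‖) * S.lip * M) := by
  have hM := h.nonneg
  have hL := S.one_le_lip
  obtain ⟨h1, h2, h3⟩ := h.extendFrom_closure hβ S.isCompact_closure_half
  have hsum : 0 ≤ ∑ k, ‖Λ k‖ := Finset.sum_nonneg fun k _ => norm_nonneg _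
  refine HolderBound.zero_iff.2 ⟨by positivity, fun x hx => ?_, fun x hx y hy => ?_, ?_⟩
  · calc ‖S.ext Λ u x‖ ≤ ∑ k, ‖Λ k‖ * M := norm_sum_le_of_le _ fun k _ =>
          (Λ k).le_of_opNorm_le_of_le le_rfl (h1 _ (S.fold_mem_closure hx))
      _ = (∑ k, ‖Λ k‖) * 1 * M := by rw [← Finset.sum_mul, mul_one]
      _ ≤ _ := by gcongr
  · have e1 : S.ext Λ u x - S.ext Λ u y = ∑ k, Λ k (extendFrom S.half u (S.fold k x) -
        extendFrom S.half u (S.fold k y)) := by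
      simp only [ext, map_sub, Finset.sum_sub_distrib]
    rw [e1]
    calc _ ≤ ∑ k, ‖Λ k‖ * (M * (S.lip * ‖x - y‖ ^ β)) := by
          refine norm_sum_le_of_le _ fun k _ => (Λ k).le_of_opNorm_le_of_le le_rfl ?_
          refine (h2 _ (S.fold_mem_closure hx) _ (S.fold_mem_closure hy)).trans ?_
          gcongr
          calc ‖S.fold k x - S.fold k y‖ ^ β ≤ (S.lip * ‖x - y‖) ^ β := by
                gcongr
                exact S.norm_fold_sub_le k x y
            _ = S.lip ^ β * ‖x - y‖ ^ β := Real.mul_rpow S.lip_pos.le (norm_nonneg _)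
            _ ≤ S.lip * ‖x - y‖ ^ β := by
                gcongr
                simpa using Real.rpow_le_rpow_of_exponent_le hL hβ1
      _ = _ := by rw [← Finset.sum_mul]; ring
  · have hk : ∀ k, UniformContinuousOn
        (fun x => Λ k (extendFrom S.half u (S.fold k x))) S.small := fun k =>
      (Λ k).uniformContinuous.comp_uniformContinuousOn (h3.comp
        (uniformContinuousOn_of_norm_sub_le_norm S.lip uniformContinuous_id.uniformContinuousOn
          fun x _ y _ => S.norm_fold_sub_le k x y) fun x hx => S.fold_mem_closure hx)
    have : ∀ t : Finset ι, UniformContinuousOn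
        (fun x => ∑ k ∈ t, Λ k (extendFrom S.half u (S.fold k x))) S.small := by
      intro t
      classical
      induction t using Finset.induction_on with
      | empty => simpa using uniformContinuous_const.uniformContinuousOn
      | insert k t hkt ih =>
        refine uniformContinuousOn_of_norm_sub_le 1 (hk k) ih fun x _ y _ => ?_
        rw [Finset.sum_insert hkt, Finset.sum_insert hkt, add_sub_add_comm, one_mul]
        exact norm_add_le _ _
    exact this Finset.univ

/-- The coefficients of the reflection of the derivative. -/
noncomputable def derivCoeff (Λ : ι → F →L[ℝ] F) (k : ι) : (E →L[ℝ] F) →L[ℝ] (E →L[ℝ] F) :=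
  (ContinuousLinearMap.compL ℝ E F F (Λ k)).comp
    ((ContinuousLinearMap.compL ℝ E E F).flip (S.refl k))

theorem derivCoeff_apply (Λ : ι → F →L[ℝ] F) (k : ι) (T : E →L[ℝ] F) :
    S.derivCoeff Λ k T = (Λ k).comp (T.comp (S.refl k)) := rfl

/-- The moment conditions which make the derivatives up to order `q` match. -/
def Moments (q : ℕ) (Λ : ι → F →L[ℝ] F) : Prop :=
  ∀ j ≤ q, ∑ k, (-S.a k) ^ j • Λ k = ContinuousLinearMap.id ℝ F

theorem Moments.sum {S : ReflectionData E ι} {q : ℕ} {Λ : ι → F →L[ℝ] F} (h : S.Moments q Λ) :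
    ∑ k, Λ k = ContinuousLinearMap.id ℝ F := by
  simpa using h 0 (Nat.zero_le q)

/-- `S.refl k` fixes the kernel of `ℓ` and multiplies `e` by `-a k`. Splitting a vector accordingly,
the tangential part uses the moment of order `j` and the normal part the moment of order `j + 1`. -/
theorem Moments.derivCoeff {S : ReflectionData E ι} {q : ℕ} {Λ : ι → F →L[ℝ] F}
    (h : S.Moments (q + 1) Λ) : S.Moments q (S.derivCoeff Λ) := by
  intro j hj
  ext T x
  have h1 := congrArg (fun A : F →L[ℝ] F => A (T (x - S.ℓ x • S.e))) (h j (by omega))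
  have h2 := congrArg (fun A : F →L[ℝ] F => A (S.ℓ x • T S.e)) (h (j + 1) (by omega))
  simp only [_root_.sum_apply, _root_.smul_apply,
    ContinuousLinearMap.id_apply] at h1 h2
  simp only [_root_.sum_apply, _root_.smul_apply,
    ContinuousLinearMap.id_apply, derivCoeff_apply, ContinuousLinearMap.comp_apply]
  have h3 : T x = T (x - S.ℓ x • S.e) + S.ℓ x • T S.e := by simp
  rw [h3]
  nth_rewrite 1 [← h1]
  nth_rewrite 1 [← h2]
  rw [← Finset.sum_add_distrib]
  refine Finset.sum_congr rfl fun k _ => ?_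
  rw [refl_apply, pow_succ]
  simp only [map_sub, map_smul]
  module

/-- The derivative of a reflection is again a reflection, of `fderiv ℝ u` with operator-valued
weights. This is what makes the induction on the order close. -/
theorem hasFDerivAt_ext [FiniteDimensional ℝ E] [CompleteSpace F] {Λ : ι → F →L[ℝ] F}
    (hΛ : S.Moments 1 Λ) {u : E → F} (hu : DifferentiableOn ℝ u S.half)
    (hu' : ContinuousOn (fderiv ℝ u) S.half) (hw : ContinuousOn (S.ext Λ u) S.small)
    (hw' : ContinuousOn (S.ext (S.derivCoeff Λ) (fderiv ℝ u)) S.small) {x : E}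
    (hx : x ∈ S.small) :
    HasFDerivAt (S.ext Λ u) (S.ext (S.derivCoeff Λ) (fderiv ℝ u) x) x := by
  have hΛ' : S.Moments 0 (S.derivCoeff Λ) := Moments.derivCoeff hΛ
  have hd : ∀ y ∈ S.half, HasFDerivAt u (fderiv ℝ u y) y := fun y hy =>
    ((hu y hy).differentiableAt (S.isOpen_half.mem_nhds hy)).hasFDerivAt
  have pos : ∀ y ∈ S.small, 0 < S.ℓ y →
      HasFDerivAt (S.ext Λ u) (S.ext (S.derivCoeff Λ) (fderiv ℝ u) y) y := fun y hy h => by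
    have hy' := S.mem_half hy h
    rw [S.ext_of_mem_half hΛ'.sum hu' hy']
    refine (hd y hy').congr_of_eventuallyEq ?_
    filter_upwards [S.isOpen_half.mem_nhds hy'] with z hz
      using S.ext_of_mem_half hΛ.sum hu.continuousOn hz
  have neg : ∀ y ∈ S.small, S.ℓ y < 0 →
      HasFDerivAt (S.ext Λ u) (S.ext (S.derivCoeff Λ) (fderiv ℝ u) y) y := fun y hy h => by
    rw [S.ext_of_neg hu' hy h]
    have h1 : HasFDerivAt (fun z => ∑ k, Λ k (u (S.refl k z)))
        (∑ k, S.derivCoeff Λ k (fderiv ℝ u (S.refl k y))) y :=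
      HasFDerivAt.fun_sum fun k _ => (Λ k).hasFDerivAt.comp y
        ((hd _ (S.refl_mem_half hy h)).comp y (S.refl k).hasFDerivAt)
    refine h1.congr_of_eventuallyEq ?_
    filter_upwards [S.isOpen_small.mem_nhds hy,
      (isOpen_lt S.ℓ.continuous continuous_const).mem_nhds h] with z hz hz'
      using S.ext_of_neg hu.continuousOn hz hz'
  rcases lt_trichotomy (S.ℓ x) 0 with h | h | h
  · exact neg x hx h
  · obtain ⟨ε, hε, hεx⟩ := Metric.isOpen_iff.1 S.isOpen_small x hx
    -- On the hyperplane, the derivatives from each open side tend to the same limit by `hw'`, so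
    -- both one-sided derivatives exist and agree; the two closed half balls together fill a
    -- neighbourhood.
    have side : ∀ ℓ' : E →L[ℝ] ℝ, (∀ y ∈ S.small, 0 < ℓ' y →
        HasFDerivAt (S.ext Λ u) (S.ext (S.derivCoeff Λ) (fderiv ℝ u) y) y) →
        HasFDerivWithinAt (S.ext Λ u) (S.ext (S.derivCoeff Λ) (fderiv ℝ u) x)
          (closure (ball x (ε / 2) ∩ {y | 0 < ℓ' y})) x := by
      intro ℓ' hℓ'
      have hsub : ball x (ε / 2) ∩ {y | 0 < ℓ' y} ⊆ S.small :=
        fun y hy => hεx (ball_subset_ball (by linarith) hy.1)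
      have hcl : closure (ball x (ε / 2) ∩ {y | 0 < ℓ' y}) ⊆ S.small := fun y hy =>
        hεx (closedBall_subset_ball (by linarith) (closure_ball_subset_closedBall
          (closure_mono inter_subset_left hy)))
      refine hasFDerivWithinAt_closure_of_tendsto_fderiv
        (fun y hy => (hℓ' y (hsub hy) hy.2).differentiableAt.differentiableWithinAt)
        ((convex_ball _ _).inter (convex_halfSpace_gt ℓ'.isLinear 0))
        (isOpen_ball.inter (isOpen_lt continuous_const ℓ'.continuous))
        (fun y hy => (hw y (hcl hy)).mono hsub) ?_
      refine ((hw' x hx).mono hsub).tendsto.congr' ?_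
      filter_upwards [self_mem_nhdsWithin] with y hy using ((hℓ' y (hsub hy) hy.2).fderiv).symm
    refine ((side S.ℓ pos).union (side (-S.ℓ) fun y hy h' => neg y hy (by simpa using h')))
      |>.hasFDerivAt ?_
    filter_upwards [ball_mem_nhds x (half_pos hε)] with y hy
    rcases le_total 0 (S.ℓ y) with h' | h'
    · exact Or.inl (mem_closure_inter_pos isOpen_ball S.ℓ S.apply_e hy h')
    · exact Or.inr (mem_closure_inter_pos isOpen_ball (-S.ℓ) (e := -S.e) (by simp [S.apply_e]) hy
        (by simpa using h'))
  · exact pos x hx h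

/-- Higher-order reflection maps `C^{q,β}` on a half ball to `C^{q,β}` on a ball. -/
theorem exists_holderBound_ext [FiniteDimensional ℝ E] [CompleteSpace F] (q : ℕ)
    (Λ : ι → F →L[ℝ] F) (hΛ : S.Moments q Λ) : ∃ C : ℝ, 0 ≤ C ∧
      ∀ (β : ℝ) (u : E → F) (M : ℝ), 0 ≤ β → β ≤ 1 → HolderBound q β S.half u M →
        HolderBound q β S.small (S.ext Λ u) (C * M) := by
  have hL := S.lip_pos
  have hsum : 0 ≤ ∑ k, ‖Λ k‖ := Finset.sum_nonneg fun k _ => norm_nonneg _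
  induction q generalizing F with
  | zero =>
    exact ⟨(∑ k, ‖Λ k‖) * S.lip, by positivity, fun β u M hβ hβ1 h => S.ext_zero Λ hβ hβ1 h⟩
  | succ q ih =>
    obtain ⟨C, hC, h⟩ := ih (S.derivCoeff Λ) hΛ.derivCoeff
      (Finset.sum_nonneg fun k _ => norm_nonneg _)
    refine ⟨C + (∑ k, ‖Λ k‖) * S.lip * 2 ^ (q + 1), by positivity, fun β u M hβ hβ1 hu => ?_⟩
    have hM := hu.nonneg
    obtain ⟨u0, u1, u2⟩ := (HolderBound.succ_iff S.isOpen_half).1 hu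
    have hu0 : HolderBound 0 β S.half u (2 ^ (q + 1) * M) := by
      clear ih h u0 u1 u2 hΛ
      induction q generalizing M with
      | zero => simpa using hu.lower S.isOpen_half S.convex_half hβ hβ1
      | succ q ih' =>
        rw [pow_succ, mul_assoc]
        exact ih' _ (hu.lower S.isOpen_half S.convex_half hβ hβ1)
          (by linarith)
    have hw := S.ext_zero Λ hβ hβ1 hu0
    have hw' := h β (fderiv ℝ u) M hβ hβ1 u2
    have hd : ∀ x ∈ S.small, HasFDerivAt (S.ext Λ u)
        (S.ext (S.derivCoeff Λ) (fderiv ℝ u) x) x := fun x hx =>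
      S.hasFDerivAt_ext (fun j hj => hΛ j (by omega)) u0 u2.contDiffOn.continuousOn
        hw.contDiffOn.continuousOn hw'.contDiffOn.continuousOn hx
    refine (HolderBound.succ_iff S.isOpen_small).2
      ⟨fun x hx => (hd x hx).differentiableAt.differentiableWithinAt,
      fun x hx => (hw.norm_apply_le x hx).trans ?_, ?_⟩
    · nlinarith [mul_nonneg hC hM]
    · refine (hw'.mono subset_rfl ?_).congr S.isOpen_small fun x hx => (hd x hx).fderiv
      have : 0 ≤ (∑ k, ‖Λ k‖) * S.lip * 2 ^ (q + 1) * M := by positivity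
      nlinarith

end ReflectionData

/-- The dilation factors `1, …, 5` of the reflection. -/
def reflectionFactor (k : Fin 5) : ℝ := (k : ℝ) + 1

/-- Weights for which the reflection with factors `1, …, 5` is exact to order four. -/
def reflectionWeight : Fin 5 → ℝ := ![15, -40, 45, -24, 5]

/-- The weights are the Lagrange basis polynomials for the nodes `-1, …, -5`, evaluated at `1`;
interpolation of `t ^ j` is exact for `j ≤ 4`. -/
theorem sum_reflectionWeight (j : ℕ) (hj : j ≤ 4) :
    ∑ k, (-reflectionFactor k) ^ j * reflectionWeight k = 1 := by
  interval_cases j <;> simp [Fin.sum_univ_succ, reflectionFactor, reflectionWeight] <;> norm_num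

end Reflection

/-! ### Cutoffs, extension by zero, and gluing of local extensions. -/

section Gluing

open scoped ContDiff

set_option linter.unusedSectionVars false

variable {E F : Type} [NormedAddCommGroup E] [NormedSpace ℝ E] [FiniteDimensional ℝ E]
  [NormedAddCommGroup F] [NormedSpace ℝ F]

/-- Bounding one derivative more than required and then lowering makes `M` independent of `β`. -/
theorem HolderBound.exists_of_hasCompactSupport (q : ℕ) {θ : E → F} (hθ : ContDiff ℝ ∞ θ)
    (hc : HasCompactSupport θ) :
    ∃ M : ℝ, ∀ β : ℝ, 0 ≤ β → β ≤ 1 → HolderBound q β univ θ M := by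
  have hb : ∀ j : ℕ, ∃ C, ∀ x, ‖iteratedFDeriv ℝ j θ x‖ ≤ C := fun j =>
    (hc.iteratedFDeriv j).exists_bound_of_continuous
      (hθ.continuous_iteratedFDeriv (by exact_mod_cast le_top))
  choose C hC using hb
  set M := ∑ j ∈ Finset.range (q + 2), C j with hM
  have hC0 : ∀ j, 0 ≤ C j := fun j => (norm_nonneg _).trans (hC j 0)
  have hjM : ∀ j ≤ q + 1, C j ≤ M := fun j hj =>
    Finset.single_le_sum (fun i _ => hC0 i) (Finset.mem_range.2 (by omega))
  have hM0 : 0 ≤ M := (hC0 0).trans (hjM 0 (by omega))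
  have h : HolderBound (q + 1) 0 univ θ (2 * M) := by
    refine ⟨by positivity, (hθ.of_le (by exact_mod_cast le_top)).contDiffOn,
      fun j hj x _ => (hC j x).trans (by linarith [hjM j hj]), fun x _ y _ => ?_, ?_⟩
    · rw [Real.rpow_zero, mul_one]
      linarith [norm_sub_le (iteratedFDeriv ℝ (q + 1) θ x) (iteratedFDeriv ℝ (q + 1) θ y),
        hC (q + 1) x, hC (q + 1) y, hjM (q + 1) le_rfl]
    · exact ((hc.iteratedFDeriv (q + 1)).uniformContinuous_of_continuous
        (hθ.continuous_iteratedFDeriv (by exact_mod_cast le_top))).uniformContinuousOn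
  exact ⟨2 * (2 * M), fun β hβ hβ1 => h.lower isOpen_univ convex_univ hβ hβ1⟩

theorem contDiff_of_contDiffAt_tsupport {n : WithTop ℕ∞} {f : E → F}
    (h : ∀ x ∈ tsupport f, ContDiffAt ℝ n f x) : ContDiff ℝ n f :=
  contDiff_iff_contDiffAt.2 fun x => by
    by_cases hx : x ∈ tsupport f
    · exact h x hx
    · exact contDiffAt_const.congr_of_eventuallyEq (notMem_tsupport_iff_eventuallyEq.1 hx)

/-- Extension by zero of a `C^{q,β}` function supported well inside a ball. -/
theorem HolderBound.univ_of_tsupport_subset {q : ℕ} {β M ρ ρ' : ℝ} {p : E} {f : E → F}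
    (hβ : 0 ≤ β) (hβ1 : β ≤ 1) (hρ : ρ' < ρ) (h : HolderBound q β (ball p ρ) f M)
    (hf : tsupport f ⊆ closedBall p ρ') :
    HolderBound q β univ f ((1 + 1 / (ρ - ρ')) * M) := by
  have hη : 0 < ρ - ρ' := sub_pos.2 hρ
  have hM := h.nonneg
  have hle : M ≤ (1 + 1 / (ρ - ρ')) * M := by
    have : 0 ≤ 1 / (ρ - ρ') * M := by positivity
    linarith
  have hsub : tsupport f ⊆ ball p ρ := hf.trans (closedBall_subset_ball hρ)
  have hzero : ∀ j, ∀ x ∉ tsupport f, iteratedFDeriv ℝ j f x = 0 := fun j x hx =>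
    Function.notMem_support.1 fun h' => hx (support_iteratedFDeriv_subset j h')
  have hcd : ContDiff ℝ q f := contDiff_of_contDiffAt_tsupport fun x hx =>
    h.contDiffOn.contDiffAt (isOpen_ball.mem_nhds (hsub hx))
  have hcs : HasCompactSupport f :=
    have := FiniteDimensional.proper_real E
    (isCompact_closedBall p ρ').of_isClosed_subset (isClosed_tsupport f) hf
  have cross : ∀ x ∈ ball p ρ, ∀ y ∉ ball p ρ,
      ‖iteratedFDeriv ℝ q f x‖ ≤ (1 + 1 / (ρ - ρ')) * M * ‖x - y‖ ^ β := by
    -- A support point and a point outside the ball are at least `ρ - ρ'` apart, so the Hölder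
    -- quotient is controlled by the sup bound.
    intro x hx y hy
    by_cases hxs : x ∈ tsupport f
    · have hd : ρ - ρ' ≤ ‖x - y‖ := by
        have h1 := mem_closedBall.1 (hf hxs)
        have h2 := not_lt.1 fun h' => hy (mem_ball.2 h')
        have h3 := dist_triangle_left y p x
        rw [dist_eq_norm x y] at h3
        linarith
      refine (h.norm_le q le_rfl x hx).trans ?_
      have key : 1 ≤ (1 + 1 / (ρ - ρ')) * ‖x - y‖ ^ β := by
        rcases le_total 1 ‖x - y‖ with h1 | h1
        · have h2 := Real.one_le_rpow h1 hβ
          have : 0 ≤ 1 / (ρ - ρ') * ‖x - y‖ ^ β := by positivity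
          linarith
        · have h2 := Real.rpow_le_rpow_of_exponent_ge (hη.trans_le hd) h1 hβ1
          rw [Real.rpow_one] at h2
          have h3 : 1 / (ρ - ρ') * (ρ - ρ') ≤ 1 / (ρ - ρ') * ‖x - y‖ ^ β := by
            gcongr
            linarith
          rw [one_div_mul_cancel hη.ne'] at h3
          have : 0 ≤ ‖x - y‖ ^ β := by positivity
          linarith
      nlinarith
    · rw [hzero q x hxs, norm_zero]
      positivity
  refine ⟨hM.trans hle, hcd.contDiffOn, fun j hj x _ => ?_, fun x _ y _ => ?_,
    ((hcs.iteratedFDeriv q).uniformContinuous_of_continuous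
      (hcd.continuous_iteratedFDeriv le_rfl)).uniformContinuousOn⟩
  · by_cases hx : x ∈ tsupport f
    · exact (h.norm_le j hj x (hsub hx)).trans hle
    · rw [hzero j x hx, norm_zero]
      exact hM.trans hle
  · by_cases hx : x ∈ ball p ρ <;> by_cases hy : y ∈ ball p ρ
    · exact (h.holder x hx y hy).trans (by gcongr)
    · rw [hzero q y fun h' => hy (hsub h'), sub_zero]
      exact cross x hx y hy
    · rw [hzero q x fun h' => hx (hsub h'), zero_sub, norm_neg, norm_sub_rev x]
      exact cross y hy x hx
    · rw [hzero q y fun h' => hy (hsub h'), hzero q x fun h' => hx (hsub h'), sub_zero, norm_zero]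
      have := hM.trans hle
      positivity

/-- A function on `D` all of whose compositions with `C^{4,α}` maps from convex open sets into `D`
are of class `C^{q,β}`, with norm controlled through `c` by the norm of the inner map. -/
def TameOn (q : ℕ) (α β : ℝ) (D : Set E) (c : ℝ → ℝ) (u : E → ℝ) (M : ℝ) : Prop :=
  0 ≤ M ∧ ∀ (N : ℝ) (V : Set E) (g : E → E), IsOpen V → Convex ℝ V → MapsTo g V D →
    HolderBound 4 α V g N → HolderBound q β V (u ∘ g) (c N * M)

/-- Tame functions on `D` extend near `p`, with uniform bounds. -/
def LocallyExtendable (q : ℕ) (α : ℝ) (D : Set E) (c : ℝ → ℝ) (p : E) : Prop :=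
  ∃ ε : ℝ, 0 < ε ∧ ∃ C : ℝ, 0 ≤ C ∧ ∀ (β : ℝ) (u : E → ℝ) (M : ℝ), 0 ≤ β → β ≤ 1 →
    (q : ℝ) + β ≤ 4 + α → TameOn q α β D c u M →
    ∃ e : E → ℝ, HolderBound q β (ball p ε) e (C * M) ∧ ∀ x ∈ ball p ε ∩ D, e x = u x

/-- Compactness induction on sets `S`: some cutoff `θ`, equal to 1 on `S`, is such that `θ * u` has
a controlled global extension from `D`. For `S = closure D` this extends `u` itself. -/
theorem exists_extension_of_locallyExtendable (q : ℕ) (α : ℝ) {D : Set E} (c : ℝ → ℝ)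
    (hD : IsCompact (closure D)) (hloc : ∀ p ∈ closure D, LocallyExtendable q α D c p)
    {δ : ℝ} (hδ : 0 < δ) :
    ∃ C : ℝ, 0 ≤ C ∧ ∀ (β : ℝ) (u : E → ℝ) (M : ℝ), 0 ≤ β → β ≤ 1 →
      (q : ℝ) + β ≤ 4 + α → TameOn q α β D c u M →
      ∃ w : E → ℝ, HolderBound q β univ w (C * M) ∧ EqOn w u D ∧
        tsupport w ⊆ cthickening δ D := by
  obtain ⟨B, hB, hmul⟩ := HolderBound.exists_bilinear (E := E) q (ContinuousLinearMap.mul ℝ ℝ)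
  suffices h : ∃ θ : E → ℝ, ContDiff ℝ ∞ θ ∧ HasCompactSupport θ ∧ (∀ x ∈ closure D, θ x = 1) ∧
      ∃ C : ℝ, 0 ≤ C ∧ ∀ (β : ℝ) (u : E → ℝ) (M : ℝ), 0 ≤ β → β ≤ 1 →
        (q : ℝ) + β ≤ 4 + α → TameOn q α β D c u M →
        ∃ w : E → ℝ, HolderBound q β univ w (C * M) ∧ (∀ x ∈ D, w x = θ x * u x) ∧
          tsupport w ⊆ cthickening δ D by
    obtain ⟨θ, -, -, h1, C, hC, h2⟩ := h
    refine ⟨C, hC, fun β u M hβ hβ1 hq hu => ?_⟩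
    obtain ⟨w, w1, w2, w3⟩ := h2 β u M hβ hβ1 hq hu
    exact ⟨w, w1, fun x hx => by rw [w2 x hx, h1 x (subset_closure hx), one_mul], w3⟩
  refine hD.induction_on (p := fun S => ∃ θ : E → ℝ, ContDiff ℝ ∞ θ ∧ HasCompactSupport θ ∧
      (∀ x ∈ S, θ x = 1) ∧
      ∃ C : ℝ, 0 ≤ C ∧ ∀ (β : ℝ) (u : E → ℝ) (M : ℝ), 0 ≤ β → β ≤ 1 →
        (q : ℝ) + β ≤ 4 + α → TameOn q α β D c u M →
        ∃ w : E → ℝ, HolderBound q β univ w (C * M) ∧ (∀ x ∈ D, w x = θ x * u x) ∧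
          tsupport w ⊆ cthickening δ D) ?_ ?_ ?_ ?_
  · refine ⟨0, contDiff_const, HasCompactSupport.zero, by simp, 0, le_rfl,
      fun β u M hβ hβ1 _ hu => ?_⟩
    have h0 : HolderBound q β (univ : Set E) (0 : E → ℝ) (0 * M) := by
      -- The zero function is treated as supported in an empty ball, so that its bound with constant
      -- 0 comes from the extension lemma.
      simpa using (HolderBound.univ_of_tsupport_subset (p := 0) (ρ := 0) (ρ' := -1) (M := 0)
        (f := (0 : E → ℝ)) hβ hβ1 (by norm_num)
        ⟨le_rfl, contDiffOn_const, by simp, by simp, by simp [UniformContinuousOn]⟩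
        (by simp [tsupport]))
    exact ⟨0, h0, by simp, by simp [tsupport]⟩
  · rintro S T hST ⟨θ, h1, h2, h3, h4⟩
    exact ⟨θ, h1, h2, fun x hx => h3 x (hST hx), h4⟩
  · rintro S T ⟨θ, hθ, hθc, hθ1, C, hC, h⟩ ⟨θ', hθ', hθc', hθ1', C', hC', h'⟩
    obtain ⟨K, hK⟩ := HolderBound.exists_of_hasCompactSupport q hθ.neg hθc.neg
    -- The cutoff is `1 - (1 - θ)(1 - θ')`, realized by `w + w' - θ w'`; only globally defined
    -- functions are multiplied.
    refine ⟨θ + (θ' - θ * θ'), hθ.add (hθ'.sub (hθ.mul hθ')),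
      hθc.add (hθc'.sub hθc.mul_right), fun x hx => ?_, C + (C' + B * (|K| * C')), by positivity,
      fun β u M hβ hβ1 hq hu => ?_⟩
    · rcases hx with hx | hx
      · simp [hθ1 x hx]
      · simp [hθ1' x hx]
    · obtain ⟨w, w1, w2, w3⟩ := h β u M hβ hβ1 hq hu
      obtain ⟨w', w1', w2', w3'⟩ := h' β u M hβ hβ1 hq hu
      have hm := hmul β univ _ _ _ _ hβ hβ1 isOpen_univ convex_univ (hK β hβ hβ1) w1'
      have hK0 := (hK β hβ hβ1).nonneg
      refine ⟨w + (w' + fun x => (-θ) x * w' x), ?_, fun x hx => ?_, ?_⟩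
      · refine (w1.add isOpen_univ (w1'.add isOpen_univ hm)).mono subset_rfl (le_of_eq ?_)
        rw [abs_of_nonneg hK0]
        ring
      · simp only [Pi.add_apply, Pi.neg_apply, Pi.sub_apply, Pi.mul_apply, w2 x hx, w2' x hx]
        ring
      · refine (tsupport_add _ _).trans (union_subset w3 ((tsupport_add _ _).trans
          (union_subset w3' ?_)))
        exact (closure_mono (Function.support_mul_subset_right _ _)).trans w3'
  · intro p hp
    obtain ⟨ε₀, hε₀, C, hC, h⟩ := hloc p hp
    obtain ⟨ε, hε, hεε₀, hεδ⟩ : ∃ ε, 0 < ε ∧ ε ≤ ε₀ ∧ ε ≤ δ :=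
      ⟨min ε₀ δ, lt_min hε₀ hδ, min_le_left _ _, min_le_right _ _⟩
    let θ : ContDiffBump p := ⟨ε / 3, ε / 2, by positivity, by linarith⟩
    obtain ⟨K, hK⟩ := HolderBound.exists_of_hasCompactSupport q θ.contDiff θ.hasCompactSupport
    refine ⟨ball p (ε / 3), mem_nhdsWithin_of_mem_nhds (ball_mem_nhds _ (by positivity)), θ,
      θ.contDiff, θ.hasCompactSupport,
      fun x hx => θ.one_of_mem_closedBall (ball_subset_closedBall hx),
      (1 + 1 / (ε - ε / 2)) * (B * (|K| * C)), ?_, fun β u M hβ hβ1 hq hu => ?_⟩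
    · have : 0 < ε - ε / 2 := by linarith
      positivity
    · obtain ⟨e, e1, e2⟩ := h β u M hβ hβ1 hq hu
      have hK0 := (hK β hβ hβ1).nonneg
      have hm := hmul β (ball p ε) _ _ _ _ hβ hβ1 isOpen_ball (convex_ball _ _)
        ((hK β hβ hβ1).mono (subset_univ _) le_rfl) (e1.mono (ball_subset_ball hεε₀) le_rfl)
      have hs : tsupport (fun x => ContinuousLinearMap.mul ℝ ℝ (θ x) (e x)) ⊆
          closedBall p (ε / 2) := by
        refine (closure_mono (Function.support_mul_subset_left _ _)).trans ?_
        exact θ.tsupport_eq.subset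
      refine ⟨_, (HolderBound.univ_of_tsupport_subset hβ hβ1 (by linarith) hm hs).mono
        subset_rfl (le_of_eq ?_), fun x hx => ?_, hs.trans ?_⟩
      · rw [abs_of_nonneg hK0]
        ring
      · by_cases hxp : x ∈ ball p ε
        · simp [e2 x ⟨ball_subset_ball hεε₀ hxp, hx⟩]
        · have : θ x = 0 := θ.zero_of_le_dist (by
            have := not_lt.1 fun h' => hxp (mem_ball.2 h')
            change ε / 2 ≤ _
            linarith)
          simp [this]
      · rw [← cthickening_closure]
        exact (closedBall_subset_cthickening hp _).trans
          (cthickening_mono (by linarith) _)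

end Gluing

/-! ### Passage between the Hölder norm and quantitative bounds. -/

section Conversion

set_option linter.unusedSectionVars false

variable {E F : Type} [NormedAddCommGroup E] [NormedSpace ℝ E] [FiniteDimensional ℝ E]
  [NormedAddCommGroup F] [NormedSpace ℝ F]

theorem InHolder.holderBound {q : ℕ} {β : ℝ≥0} {Ω : Set E} {f : E → F}
    (hΩ : Bornology.IsBounded Ω) (h : InHolder q β Ω f) :
    HolderBound q β Ω f (holderNorm q β Ω f).toReal := by
  have htop := h.norm_lt_top.ne
  refine ⟨ENNReal.toReal_nonneg, h.contDiffOn, fun j hj x hx => ?_, fun x hx y hy => ?_, ?_⟩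
  · rw [← toReal_enorm]
    refine ENNReal.toReal_mono htop ?_
    calc ‖iteratedFDeriv ℝ j f x‖ₑ ≤ ⨆ x ∈ Ω, ‖iteratedFDeriv ℝ j f x‖ₑ :=
          le_iSup₂ (f := fun x (_ : x ∈ Ω) => ‖iteratedFDeriv ℝ j f x‖ₑ) x hx
      _ ≤ ∑ j ∈ Finset.range (q + 1), ⨆ x ∈ Ω, ‖iteratedFDeriv ℝ j f x‖ₑ :=
          Finset.single_le_sum (f := fun j => ⨆ x ∈ Ω, ‖iteratedFDeriv ℝ j f x‖ₑ)
            (fun _ _ => zero_le) (Finset.mem_range.2 (by omega))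
      _ ≤ _ := le_self_add
  · have hle : eHolderNorm β (fun x : Ω => iteratedFDeriv ℝ q f x) ≤ holderNorm q β Ω f :=
      le_add_self
    have hm : MemHolder β (fun x : Ω => iteratedFDeriv ℝ q f x) :=
      eHolderNorm_lt_top.1 (hle.trans_lt h.norm_lt_top)
    have h1 := hm.holderWith.dist_le ⟨x, hx⟩ ⟨y, hy⟩
    rw [dist_eq_norm, Subtype.dist_eq, dist_eq_norm] at h1
    refine h1.trans ?_
    gcongr
    exact ENNReal.toReal_mono htop hle
  -- The continuous extension to the compact closure yields uniform continuity, also for `β = 0`.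
  · obtain ⟨g, hg, hgf⟩ := h.extend q le_rfl
    have := FiniteDimensional.proper_real E
    exact ((hΩ.isCompact_closure.uniformContinuousOn_of_continuous hg).mono subset_closure).congr
      hgf

theorem HolderBound.holderNorm_le {q : ℕ} {β : ℝ≥0} {Ω : Set E} {f : E → F} {M : ℝ}
    (h : HolderBound q β Ω f M) : holderNorm q β Ω f ≤ ENNReal.ofReal ((q + 2) * M) := by
  have h1 : ∑ j ∈ Finset.range (q + 1), ⨆ x ∈ Ω, ‖iteratedFDeriv ℝ j f x‖ₑ ≤
      ∑ _j ∈ Finset.range (q + 1), ENNReal.ofReal M :=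
    Finset.sum_le_sum fun j hj => iSup₂_le fun x hx => by
      rw [← ofReal_norm]
      exact ENNReal.ofReal_le_ofReal (h.norm_le j (by simpa [Nat.lt_succ_iff] using hj) x hx)
  have h2 : eHolderNorm β (fun x : Ω => iteratedFDeriv ℝ q f x) ≤ ENNReal.ofReal M := by
    have : HolderWith M.toNNReal β (fun x : Ω => iteratedFDeriv ℝ q f x) := by
      intro x y
      rw [edist_dist, edist_dist, dist_eq_norm, Subtype.dist_eq, dist_eq_norm,
        ENNReal.ofReal_rpow_of_nonneg (norm_nonneg _) β.coe_nonneg]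
      change _ ≤ ENNReal.ofReal M * _
      rw [← ENNReal.ofReal_mul h.nonneg]
      exact ENNReal.ofReal_le_ofReal (h.holder x x.2 y y.2)
    exact this.eHolderNorm_le
  refine (add_le_add h1 h2).trans (le_of_eq ?_)
  rw [Finset.sum_const, Finset.card_range, nsmul_eq_mul, ← ENNReal.ofReal_natCast,
    ← ENNReal.ofReal_mul (by positivity),
    ← ENNReal.ofReal_add (mul_nonneg (by positivity) h.nonneg) h.nonneg]
  congr 1
  push_cast
  ring

open scoped ContDiff in
-- Multiplication by a bump function equal to 1 near `p` reduces to the compactly supported case.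
theorem HolderBound.exists_of_contDiffOn (q : ℕ) {β : ℝ} (hβ : 0 ≤ β) (hβ1 : β ≤ 1)
    {O : Set E} (hO : IsOpen O) {f : E → F} (hf : ContDiffOn ℝ ∞ f O) {p : E} (hp : p ∈ O) :
    ∃ s : ℝ, 0 < s ∧ ∃ M : ℝ, HolderBound q β (ball p s) f M := by
  have := FiniteDimensional.proper_real E
  obtain ⟨s, hs, hsO⟩ := Metric.isOpen_iff.1 hO p hp
  let θ : ContDiffBump p := ⟨s / 3, s / 2, by positivity, by linarith⟩
  have hsupp : tsupport (fun x => θ x • f x) ⊆ tsupport θ :=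
    closure_mono (Function.support_smul_subset_left _ _)
  have hc : HasCompactSupport (fun x => θ x • f x) :=
    θ.hasCompactSupport.of_isClosed_subset isClosed_closure hsupp
  have hcd : ContDiff ℝ ∞ (fun x => θ x • f x) := contDiff_of_contDiffAt_tsupport fun x hx => by
    have hx' : x ∈ O := by
      have h1 := hsupp hx
      rw [θ.tsupport_eq] at h1
      exact hsO (closedBall_subset_ball (by change s / 2 < s; linarith) h1)
    exact θ.contDiff.contDiffAt.smul (hf.contDiffAt (hO.mem_nhds hx'))
  obtain ⟨M, hM⟩ := HolderBound.exists_of_hasCompactSupport q hcd hc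
  refine ⟨s / 3, by positivity, M, ((hM β hβ hβ1).mono (subset_univ _) le_rfl).congr isOpen_ball
    fun x hx => ?_⟩
  have : θ x = 1 := θ.one_of_mem_closedBall (ball_subset_closedBall hx)
  simp [this]

end Conversion

/-! ### Local extension through a straightening chart. -/

section Charts

variable {E : Type} [NormedAddCommGroup E] [NormedSpace ℝ E] [FiniteDimensional ℝ E]

theorem locallyExtendable_of_mem (q : ℕ) {α : ℝ} (hα0 : 0 ≤ α) (hα1 : α ≤ 1) {D : Set E}
    (hD : IsOpen D) (c : ℝ → ℝ) {p : E} (hp : p ∈ D) : LocallyExtendable q α D c p := by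
  obtain ⟨s, hs, N, hN⟩ := HolderBound.exists_of_contDiffOn (F := E) 4 hα0 hα1 hD
    contDiff_id.contDiffOn hp
  obtain ⟨t, ht, htD⟩ := Metric.isOpen_iff.1 hD p hp
  refine ⟨min s t, lt_min hs ht, |c N|, abs_nonneg _, fun β u M hβ hβ1 hq hu => ⟨u, ?_,
    fun x _ => rfl⟩⟩
  exact (hu.2 N _ id isOpen_ball (convex_ball _ _)
    (fun x hx => htD (ball_subset_ball (min_le_right _ _) hx))
    (hN.mono (ball_subset_ball (min_le_left s t)) le_rfl)).mono subset_rfl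
    (mul_le_mul_of_nonneg_right (le_abs_self _) hu.1)

theorem moments_reflectionWeight {q : ℕ} (hq : q ≤ 4) (S : ReflectionData E (Fin 5))
    (hS : S.a = reflectionFactor) :
    S.Moments q fun k => reflectionWeight k • ContinuousLinearMap.id ℝ ℝ := by
  intro j hj
  have h := sum_reflectionWeight j (hj.trans hq)
  simp only [hS, smul_smul]
  rw [← Finset.sum_smul, h, one_smul]

/-- Local extension near a boundary point at which `D` is straightened by `ψ`, with local
inverse `χ`, to the half space `0 < ℓ`. -/
theorem locallyExtendable_of_chart (q : ℕ) {α : ℝ} (hα1 : α < 1) {D : Set E} (c : ℝ → ℝ)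
    {p e : E} (ℓ : E →L[ℝ] ℝ) (he : ℓ e = 1) {ψ χ : E → E} (hp : ℓ (ψ p) = 0)
    {s ε N₁ N₂ : ℝ} (hs : 0 < s) (hε : 0 < ε) (hψ : HolderBound 4 α (ball p ε) ψ N₁)
    (hχ : HolderBound 4 α (ball (ψ p) s ∩ {y | 0 < ℓ y}) χ N₂)
    (hχD : MapsTo χ (ball (ψ p) s ∩ {y | 0 < ℓ y}) D)
    (hinv : ∀ x ∈ ball p ε ∩ D, 0 < ℓ (ψ x) ∧ χ (ψ x) = x) :
    LocallyExtendable q α D c p := by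
  by_cases hq4 : q ≤ 4
  swap
  -- For `q ≥ 5` the condition `q + β ≤ 4 + α < 5` fails, so nothing is to be extended.
  · refine ⟨1, one_pos, 0, le_rfl, fun β u M hβ hβ1 hq => ?_⟩
    have : (5 : ℝ) ≤ q := by exact_mod_cast not_le.1 hq4
    linarith
  let S : ReflectionData E (Fin 5) :=
    ⟨ℓ, e, reflectionFactor, ψ p, s, he, hp, fun k => by unfold reflectionFactor; positivity⟩
  obtain ⟨C₁, hC₁, h₁⟩ := S.exists_holderBound_ext q _ (moments_reflectionWeight hq4 S rfl)
  obtain ⟨C₂, hC₂, h₂⟩ :=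
    HolderBound.exists_comp (E := E) (F := E) (G := ℝ) q (2 ^ 5 * N₁)
  have hsmall : S.small ∈ nhds (ψ p) := ball_mem_nhds _ (div_pos hs S.lip_pos)
  have hcont : ContinuousAt ψ p :=
    hψ.contDiffOn.continuousOn.continuousAt (ball_mem_nhds _ hε)
  obtain ⟨t, ht, htS⟩ := Metric.mem_nhds_iff.1 (hcont hsmall)
  have hsub : ball p (min ε t) ⊆ ball p ε := ball_subset_ball (min_le_left _ _)
  have hmaps : MapsTo ψ (ball p (min ε t)) S.small :=
    fun x hx => htS (ball_subset_ball (min_le_right _ _) hx)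
  have hψ' := hψ.mono hsub le_rfl
  refine ⟨min ε t, lt_min hε ht, C₂ * (C₁ * |c N₂|), by positivity,
    fun β u M hβ hβ1 hq hu => ?_⟩
  -- The half ball is convex, so tameness applies to `χ`; the extension is the reflection of `u ∘ χ`
  -- composed with `ψ`.
  have hu' := hu.2 N₂ S.half χ S.isOpen_half S.convex_half hχD hχ
  have hext := h₁ β (u ∘ χ) _ hβ hβ1 hu'
  have hN := hψ.nonneg
  refine ⟨_, (h₂ β S.small _ _ ψ _ hβ hβ1 S.isOpen_small isOpen_ball (convex_ball _ _) hmaps hext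
    (hψ'.lower_of_le isOpen_ball (convex_ball _ _) hβ hβ1 hα1 (by exact_mod_cast hq))
    fun x hx y hy => (hψ'.lipschitz isOpen_ball (convex_ball _ _) x hx y hy).trans
      (by gcongr; linarith)).mono subset_rfl ?_, fun x hx => ?_⟩
  · have := mul_le_mul_of_nonneg_right (le_abs_self (c N₂)) hu.1
    calc C₂ * (C₁ * (c N₂ * M)) ≤ C₂ * (C₁ * (|c N₂| * M)) := by gcongr
      _ = _ := by ring
  · obtain ⟨hx1, hx2⟩ := hinv x ⟨hsub hx.1, hx.2⟩
    rw [Function.comp_apply, S.ext_of_mem_half (moments_reflectionWeight hq4 S rfl).sum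
      hu'.contDiffOn.continuousOn (S.mem_half (hmaps hx.1) hx1), Function.comp_apply, hx2]

end Charts

/-! ### Charts for the outer boundary and for the removed sphere. -/

section BasicDesign

open scoped ContDiff Topology RealInnerProductSpace

variable {α : ℝ≥0} {Ω₀ : Set E3} {z : E3} {r : ℝ}

theorem IsHolderDomain.locallyExtendable (q : ℕ) (hα1 : α < 1) (hΩ₀ : IsHolderDomain 4 α Ω₀)
    (hB : closedBall z r ⊆ Ω₀) (c : ℝ → ℝ) {p : E3} (hp : p ∈ frontier Ω₀) :
    LocallyExtendable q α (basicDesign Ω₀ z r) c p := by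
  obtain ⟨ρ, hρ, ψ, χ, hW, hχψ, hpos, hzero, hψ, hχ⟩ := hΩ₀.chart p hp
  have hpW : ψ p ∈ ψ '' ball p ρ := mem_image_of_mem _ (mem_ball_self hρ)
  have hψb := hψ.holderBound isBounded_ball
  have hWb : Bornology.IsBounded (ψ '' ball p ρ) :=
    (isBounded_iff_forall_norm_le.2 ⟨_, by
      rintro _ ⟨x, hx, rfl⟩
      exact hψb.norm_apply_le x hx⟩)
  have hχb := hχ.holderBound hWb
  have hpB : p ∉ closedBall z r := fun h => hp.2 (hΩ₀.isOpen.interior_eq.symm ▸ hB h)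
  have hχp : χ (ψ p) = p := hχψ (mem_ball_self hρ)
  have hχc : ContinuousAt χ (ψ p) :=
    hχb.contDiffOn.continuousOn.continuousAt (hW.mem_nhds hpW)
  have hn : (closedBall z r)ᶜ ∈ 𝓝 (χ (ψ p)) := by
    rw [hχp]
    exact isClosed_closedBall.isOpen_compl.mem_nhds hpB
  obtain ⟨s, hs, hsW⟩ := Metric.mem_nhds_iff.1 (Filter.inter_mem (hW.mem_nhds hpW) (hχc hn))
  let ℓ : E3 →L[ℝ] ℝ := EuclideanSpace.proj 2
  have hhalf : ∀ y ∈ ball (ψ p) s ∩ {y | 0 < ℓ y}, χ y ∈ ball p ρ ∧ ψ (χ y) = y := by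
    rintro y ⟨hy, -⟩
    obtain ⟨x, hx, rfl⟩ := (hsW hy).1
    rw [hχψ hx]
    exact ⟨hx, rfl⟩
  -- The chart only says where points of `Ω₀` go. Conversely, the image of the half ball is
  -- connected, meets `Ω₀`, and avoids the frontier, which is sent to the plane; hence it lies in
  -- `Ω₀`.
  have hsub : χ '' (ball (ψ p) s ∩ {y | 0 < ℓ y}) ⊆ Ω₀ := by
    refine IsPreconnected.subset_of_closure_inter_subset ?_ hΩ₀.isOpen ?_ ?_
    · refine (((convex_ball _ _).inter (convex_halfSpace_gt ℓ.isLinear 0)).isPreconnected).image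
        _ (hχb.contDiffOn.continuousOn.mono fun y hy => (hsW hy.1).1)
    · have hψc : ContinuousAt ψ p :=
        hψb.contDiffOn.continuousOn.continuousAt (ball_mem_nhds _ hρ)
      obtain ⟨x, ⟨hx1, hx2⟩, hx3⟩ := mem_closure_iff_nhds.1 hp.1 _
        (Filter.inter_mem (hψc (ball_mem_nhds _ hs)) (ball_mem_nhds p hρ))
      exact ⟨x, ⟨ψ x, ⟨hx1, hpos x ⟨hx2, hx3⟩⟩, hχψ hx2⟩, hx3⟩
    · rintro _ ⟨hx, y, hy, rfl⟩
      by_contra hn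
      obtain ⟨h1, h2⟩ := hhalf y hy
      have h3 := hzero (χ y) ⟨h1, hx, fun h => hn (interior_subset h)⟩
      rw [h2] at h3
      exact hy.2.ne' h3
  refine locallyExtendable_of_chart q (by exact_mod_cast hα1) c ℓ
    (e := EuclideanSpace.single 2 1) (by simp [ℓ]) (χ := χ)
    (hzero p ⟨mem_ball_self hρ, hp⟩) hs hρ hψb
    (hχb.mono (fun y hy => (hsW hy.1).1) le_rfl)
    (fun y hy => ⟨hsub (mem_image_of_mem _ hy), (hsW hy.1).2⟩)
    fun x hx => ⟨hpos x ⟨hx.1, hx.2.1⟩, hχψ hx.1⟩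

/-- The inversion in the sphere of squared radius `k` centered at the origin. -/
noncomputable def originInversion (k : ℝ) (y : E3) : E3 := (k / ‖y‖ ^ 2) • y

theorem contDiffOn_originInversion (k : ℝ) : ContDiffOn ℝ ∞ (originInversion k) {0}ᶜ := by
  intro y hy
  have h : ‖y‖ ^ 2 ≠ 0 := pow_ne_zero 2 (norm_ne_zero_iff.2 hy)
  have h1 : ContDiffAt ℝ ∞ (fun y : E3 => ‖y‖ ^ 2) y := (contDiff_norm_sq ℝ).contDiffAt
  exact ((contDiffAt_const.div h1 h).smul contDiffAt_id).contDiffWithinAt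

theorem norm_sq_originInversion {k : ℝ} {y : E3} (hy : y ≠ 0) :
    ‖originInversion k y‖ ^ 2 = k ^ 2 / ‖y‖ ^ 2 := by
  have : ‖y‖ ≠ 0 := norm_ne_zero_iff.2 hy
  rw [originInversion, norm_smul, mul_pow, Real.norm_eq_abs, sq_abs]
  field_simp

theorem originInversion_ne_zero {k : ℝ} (hk : k ≠ 0) {y : E3} (hy : y ≠ 0) :
    originInversion k y ≠ 0 :=
  smul_ne_zero (div_ne_zero hk (pow_ne_zero 2 (norm_ne_zero_iff.2 hy))) hy

theorem originInversion_originInversion {k : ℝ} (hk : k ≠ 0) {y : E3} (hy : y ≠ 0) :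
    originInversion k (originInversion k y) = y := by
  have : ‖y‖ ≠ 0 := norm_ne_zero_iff.2 hy
  conv_lhs => rw [originInversion, norm_sq_originInversion hy]
  rw [originInversion, smul_smul]
  have : k / (k ^ 2 / ‖y‖ ^ 2) * (k / ‖y‖ ^ 2) = 1 := by field_simp
  rw [this, one_smul]

/-- In coordinates centred at the antipode, inversion straightens the sphere. -/
theorem inner_originInversion_lt_iff {n y : E3} (hy : y ≠ 0) :
    ⟪n, originInversion (4 * ‖n‖ ^ 2) y⟫ < 2 * ‖n‖ ^ 2 ↔
      0 < ‖n‖ ^ 2 * (‖y - n‖ ^ 2 - ‖n‖ ^ 2) := by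
  have h : 0 < ‖y‖ ^ 2 := by have := norm_pos_iff.2 hy; positivity
  rw [originInversion, real_inner_smul_right, div_mul_eq_mul_div, div_lt_iff₀ h,
    norm_sub_sq_real, real_inner_comm]
  constructor <;> intro h' <;> nlinarith

/-- Inversion centred at the antipode `z - n` of `p` sends the sphere to a plane. The factor `4 *
‖n‖ ^ 2` makes it fix `p`, and its being an involution supplies the inverse chart. -/
theorem locallyExtendable_sphere (q : ℕ) (hα1 : α < 1) (hr : 0 < r) (hΩ₀ : IsOpen Ω₀)
    (hB : closedBall z r ⊆ Ω₀) (c : ℝ → ℝ) {p : E3} (hp : p ∈ sphere z r) :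
    LocallyExtendable q α (basicDesign Ω₀ z r) c p := by
  have hα1' : (α : ℝ) ≤ 1 := by exact_mod_cast hα1.le
  set n := p - z with hn
  have hnr : ‖n‖ = r := by rw [hn, ← dist_eq_norm]; exact hp
  have hn0 : n ≠ 0 := norm_pos_iff.1 (hnr ▸ hr)
  have hn2 : 0 < ‖n‖ ^ 2 := by rw [hnr]; positivity
  have hk : 4 * ‖n‖ ^ 2 ≠ 0 := by positivity
  have h2n : (2 : ℝ) • n ≠ 0 := smul_ne_zero two_ne_zero hn0
  let J := originInversion (4 * ‖n‖ ^ 2)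
  have hJ2n : J ((2 : ℝ) • n) = (2 : ℝ) • n := by
    simp only [J, originInversion, norm_smul, mul_pow]
    rw [Real.norm_ofNat, show 4 * ‖n‖ ^ 2 / (2 ^ 2 * ‖n‖ ^ 2) = 1 by field_simp; norm_num, one_smul]
  let ψ : E3 → E3 := fun x => (2 : ℝ) • n - J (x - (z - n))
  let χ : E3 → E3 := fun w => (z - n) + J ((2 : ℝ) • n - w)
  have hpa : p - (z - n) = (2 : ℝ) • n := by rw [hn]; module
  have hψp : ψ p = 0 := by simp only [ψ, hpa, hJ2n, sub_self]
  have hχ0 : χ 0 = p := by simp only [χ, sub_zero, hJ2n]; rw [← hpa]; abel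
  let ℓ : E3 →L[ℝ] ℝ := (1 / ‖n‖ ^ 2) • innerSL ℝ n
  have hℓ : ∀ y, ℓ y = 1 / ‖n‖ ^ 2 * ⟪n, y⟫ := fun y => rfl
  have hℓpos : ∀ y, 0 < ℓ ((2 : ℝ) • n - y) ↔ ⟪n, y⟫ < 2 * ‖n‖ ^ 2 := fun y => by
    rw [hℓ, mul_pos_iff_of_pos_left (by positivity), inner_sub_right, real_inner_smul_right,
      real_inner_self_eq_norm_sq, sub_pos]
  have hO₁ : IsOpen {x : E3 | x - (z - n) ≠ 0} :=
    isOpen_ne.preimage (continuous_id.sub continuous_const)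
  have hO₂ : IsOpen {w : E3 | (2 : ℝ) • n - w ≠ 0} :=
    isOpen_ne.preimage (continuous_const.sub continuous_id)
  have hψs : ContDiffOn ℝ ∞ ψ {x : E3 | x - (z - n) ≠ 0} :=
    contDiffOn_const.sub ((contDiffOn_originInversion _).comp
      (contDiff_id.sub contDiff_const).contDiffOn fun x hx => hx)
  have hχs : ContDiffOn ℝ ∞ χ {w : E3 | (2 : ℝ) • n - w ≠ 0} :=
    contDiffOn_const.add ((contDiffOn_originInversion _).comp
      (contDiff_const.sub contDiff_id).contDiffOn fun x hx => hx)
  have hp₁ : p ∈ {x : E3 | x - (z - n) ≠ 0} := by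
    change p - (z - n) ≠ 0
    rwa [hpa]
  have hp₂ : (0 : E3) ∈ {w : E3 | (2 : ℝ) • n - w ≠ 0} := by
    change (2 : ℝ) • n - 0 ≠ 0
    rwa [sub_zero]
  obtain ⟨ε₁, hε₁, N₁, hN₁⟩ := HolderBound.exists_of_contDiffOn 4 α.coe_nonneg hα1' hO₁ hψs hp₁
  obtain ⟨s₁, hs₁, N₂, hN₂⟩ := HolderBound.exists_of_contDiffOn 4 α.coe_nonneg hα1' hO₂ hχs hp₂
  obtain ⟨ε₂, hε₂, hε₂O⟩ := Metric.isOpen_iff.1 hO₁ p hp₁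
  have hχc : ContinuousAt χ 0 := hχs.continuousOn.continuousAt (hO₂.mem_nhds hp₂)
  have hpΩ : Ω₀ ∈ 𝓝 (χ 0) := by
    rw [hχ0]
    exact hΩ₀.mem_nhds (hB (sphere_subset_closedBall hp))
  obtain ⟨s₂, hs₂, hs₂O⟩ := Metric.mem_nhds_iff.1
    (Filter.inter_mem (hO₂.mem_nhds hp₂) (hχc hpΩ))
  refine locallyExtendable_of_chart q (by exact_mod_cast hα1) c ℓ (e := n) (ψ := ψ) (χ := χ)
    ?_ ?_ (lt_min hs₁ hs₂) (lt_min hε₁ hε₂)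
    (hN₁.mono (ball_subset_ball (min_le_left _ _)) le_rfl) (N₂ := N₂) ?_ ?_ ?_
  · rw [hℓ, real_inner_self_eq_norm_sq, one_div_mul_cancel hn2.ne']
  · rw [hψp, map_zero]
  · rw [hψp]
    exact hN₂.mono (inter_subset_left.trans (ball_subset_ball (min_le_left _ _))) le_rfl
  · rw [hψp]
    rintro w ⟨hw, hw'⟩
    obtain ⟨hw0, hwΩ⟩ := hs₂O (ball_subset_ball (min_le_right _ _) hw)
    refine ⟨hwΩ, fun hball => ?_⟩
    have hw0' : (2 : ℝ) • n - w ≠ 0 := hw0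
    have h1 := (inner_originInversion_lt_iff (n := n) (originInversion_ne_zero hk hw0')).1 (by
      rw [originInversion_originInversion hk hw0', ← hℓpos, sub_sub_cancel]
      exact hw')
    have h2 : ‖J ((2 : ℝ) • n - w) - n‖ ≤ r := by
      have h3 : J ((2 : ℝ) • n - w) - n = χ w - z := by simp only [χ]; abel
      rw [h3, ← dist_eq_norm]
      exact hball
    have h4 : ‖J ((2 : ℝ) • n - w) - n‖ ^ 2 ≤ ‖n‖ ^ 2 := by rw [hnr]; gcongr
    have h5 := pos_of_mul_pos_right h1 hn2.le
    exact absurd h4 (not_le.2 (by linarith))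
  · rintro x ⟨hx, hxD⟩
    have hx0 : x - (z - n) ≠ 0 := hε₂O (ball_subset_ball (min_le_right _ _) hx)
    constructor
    · rw [hℓpos, inner_originInversion_lt_iff hx0]
      have h1 : r < ‖x - (z - n) - n‖ := by
        rw [show x - (z - n) - n = x - z by abel, ← dist_eq_norm]
        exact not_le.1 fun h => hxD.2 (mem_closedBall.2 h)
      have h2 : ‖n‖ ^ 2 < ‖x - (z - n) - n‖ ^ 2 := by rw [hnr]; gcongr
      exact mul_pos hn2 (sub_pos.2 h2)
    · simp only [χ, ψ, sub_sub_cancel, J]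
      rw [originInversion_originInversion hk hx0]
      abel

theorem isOpen_basicDesign (hΩ₀ : IsOpen Ω₀) : IsOpen (basicDesign Ω₀ z r) :=
  hΩ₀.sdiff isClosed_closedBall

theorem locallyExtendable_basicDesign (q : ℕ) (hα1 : α < 1) (hr : 0 < r)
    (hΩ₀ : IsHolderDomain 4 α Ω₀) (hB : closedBall z r ⊆ Ω₀) (c : ℝ → ℝ) {p : E3}
    (hp : p ∈ closure (basicDesign Ω₀ z r)) :
    LocallyExtendable q α (basicDesign Ω₀ z r) c p := by
  by_cases hpD : p ∈ basicDesign Ω₀ z r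
  · exact locallyExtendable_of_mem q α.coe_nonneg (by exact_mod_cast hα1.le)
      (isOpen_basicDesign hΩ₀.isOpen) c hpD
  by_cases hpΩ : p ∈ Ω₀
  · have hpB : p ∈ closedBall z r := by_contra fun h => hpD ⟨hpΩ, h⟩
    refine locallyExtendable_sphere q hα1 hr hΩ₀.isOpen hB c
      (le_antisymm hpB (not_lt.1 fun h => ?_))
    obtain ⟨x, hx, hxD⟩ := mem_closure_iff.1 hp _ isOpen_ball (mem_ball.2 h)
    exact hxD.2 (ball_subset_closedBall hx)
  · exact hΩ₀.locallyExtendable q hα1 hB c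
      ⟨closure_mono sdiff_subset hp, fun h => hpΩ (interior_subset h)⟩

end BasicDesign

/-! ### Design variables preserve the open ball. -/

section Design

open Filter
open scoped Topology

variable {E : Type} [NormedAddCommGroup E] [NormedSpace ℝ E] [FiniteDimensional ℝ E]

/-- A `C¹` map which expands distances up to a constant is open. -/
theorem map_nhds_eq_of_lipschitz_leftInverse {f : E → E} {U : Set E} (hU : IsOpen U)
    (hf : ContDiffOn ℝ 1 f U) {K : ℝ}
    (hK : ∀ x ∈ U, ∀ y ∈ U, ‖x - y‖ ≤ K * ‖f x - f y‖) {x : E} (hx : x ∈ U) :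
    Filter.map f (𝓝 x) = 𝓝 (f x) := by
  have := FiniteDimensional.complete ℝ E
  have hs := (hf.contDiffAt (hU.mem_nhds hx)).hasStrictFDerivAt one_ne_zero
  refine hs.map_nhds_eq_of_surj (LinearMap.range_eq_top.2 ?_)
  -- Applied to difference quotients, the expansion bound gives `‖h‖ ≤ K * ‖fderiv ℝ f x h‖`; the
  -- derivative is thus injective, hence surjective in finite dimension.
  refine LinearMap.injective_iff_surjective.1
    ((injective_iff_map_eq_zero (fderiv ℝ f x : E →ₗ[ℝ] E)).2 fun h hh => ?_)
  have hlim : Tendsto (fun t : ℝ => K * ‖t⁻¹ • (f (x + t • h) - f x)‖) (𝓝[≠] 0)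
      (𝓝 (K * ‖fderiv ℝ f x h‖)) := by
    have h1 := (hs.hasFDerivAt.hasLineDerivAt h).tendsto_slope_zero
    exact h1.norm.const_mul K
  have hmem : ∀ᶠ t : ℝ in 𝓝[≠] 0, x + t • h ∈ U := by
    have hc : Continuous fun t : ℝ => x + t • h := by fun_prop
    refine (hc.tendsto 0).mono_left nhdsWithin_le_nhds |>.eventually (hU.mem_nhds ?_)
    simpa using hx
  have hle : ‖h‖ ≤ K * ‖fderiv ℝ f x h‖ := by
    refine ge_of_tendsto hlim ?_
    filter_upwards [hmem, self_mem_nhdsWithin] with t ht ht0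
    have ht0' : 0 < ‖t‖ := norm_pos_iff.2 ht0
    have h1 := hK _ ht x hx
    rw [add_sub_cancel_left, norm_smul] at h1
    rw [norm_smul, norm_inv]
    calc ‖h‖ = ‖t‖⁻¹ * (‖t‖ * ‖h‖) := by field_simp
      _ ≤ ‖t‖⁻¹ * (K * ‖f (x + t • h) - f x‖) := by gcongr
      _ = _ := by ring
  have h0 : fderiv ℝ f x h = 0 := hh
  rw [h0, norm_zero, mul_zero] at hle
  exact norm_le_zero_iff.1 hle

/-- A map of a closed ball into itself which is `C¹` inside and has a left inverse which is `C¹`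
up to the boundary maps the open ball into itself. -/
theorem mapsTo_ball_of_leftInvOn {q : ℕ} {α K : ℝ} {z : E} {R : ℝ} {Φ Ψ : E → E}
    (hΦ : HolderBound (q + 1) α (ball z R) Φ K) (hΨ : HolderBound (q + 1) α (ball z R) Ψ K)
    (hΨc : ContinuousOn Ψ (closure (ball z R)))
    (hm : MapsTo Φ (closure (ball z R)) (closure (ball z R)))
    (hinv : LeftInvOn Ψ Φ (closure (ball z R))) : MapsTo Φ (ball z R) (ball z R) := by
  intro x hx
  have hR : R ≠ 0 := (pos_of_mem_ball hx).ne'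
  have hL : LipschitzOnWith K.toNNReal Ψ (closure (ball z R)) := by
    refine LipschitzOnWith.closure hΨc (LipschitzOnWith.of_dist_le_mul fun a ha b hb => ?_)
    rw [Real.coe_toNNReal _ hΨ.nonneg, dist_eq_norm, dist_eq_norm]
    exact hΨ.lipschitz isOpen_ball (convex_ball _ _) a ha b hb
  have hnhds := map_nhds_eq_of_lipschitz_leftInverse isOpen_ball
    (hΦ.contDiffOn.of_le (by push_cast; exact le_add_self)) (K := K) (fun a ha b hb => by
      have h1 := hL.dist_le_mul _ (hm (subset_closure ha)) _ (hm (subset_closure hb))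
      rwa [hinv (subset_closure ha), hinv (subset_closure hb), Real.coe_toNNReal _ hΨ.nonneg,
        dist_eq_norm, dist_eq_norm] at h1) hx
  -- `Φ` is open at interior points, so `Φ x` is interior to the closed ball.
  have h2 : closure (ball z R) ∈ 𝓝 (Φ x) := by
    rw [← hnhds, Filter.mem_map]
    filter_upwards [isOpen_ball.mem_nhds hx] with y hy using hm (subset_closure hy)
  rw [closure_ball z hR] at h2
  rw [← interior_closedBall z hR]
  exact mem_interior_iff_mem_nhds.2 h2

end Design

/-! ### Transport to the baseline shape and the uniform extension. -/

/-- Pull-backs by `C^{4,α}` maps are tame, with a control that depends only on the bound `K`. -/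
theorem exists_tameOn_comp (q : ℕ) {α K : ℝ} (hα0 : 0 ≤ α) (hα1 : α < 1) :
    ∃ c : ℝ → ℝ, ∀ (β : ℝ) (B D Ω : Set E3) (Φ : E3 → E3) (v : E3 → ℝ) (M : ℝ),
      0 ≤ β → β ≤ 1 → (q : ℝ) + β ≤ 4 + α → IsOpen B → IsOpen Ω → D ⊆ B → MapsTo Φ D Ω →
      HolderBound 4 α B Φ K → HolderBound q β Ω v M → TameOn q α β D c (v ∘ Φ) M := by
  choose C₁ hC₁ h₁ using fun N => HolderBound.exists_comp (E := E3) (F := E3) (G := E3) 4 N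
  choose C₂ hC₂ h₂ using fun N => HolderBound.exists_comp (E := E3) (F := E3) (G := ℝ) q N
  refine ⟨fun N => C₂ (2 ^ 5 * (C₁ N * K)), fun β B D Ω Φ v M hβ hβ1 hq hB hΩ hDB hm hΦ hv =>
    ⟨hv.nonneg, fun N V g hV hVc hg hgN => ?_⟩⟩
  have hcomp := h₁ N α B V Φ g K hα0 hα1.le hB hV hVc (fun x hx => hDB (hg hx)) hΦ hgN
    (hgN.lipschitz hV hVc)
  have h0 := hcomp.nonneg
  -- The composition is bracketed as `v ∘ (Φ ∘ g)`: the inner map lives on the convex `V`, so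
  -- neither `D` nor `Ω` has to be convex.
  exact h₂ _ β Ω V v (Φ ∘ g) M hβ hβ1 hΩ hV hVc (fun x hx => hm (hg hx)) hv
    (hcomp.lower_of_le hV hVc hβ hβ1 hα1 (by exact_mod_cast hq))
    fun x hx y hy => (hcomp.lipschitz hV hVc x hx y hy).trans
      (mul_le_mul_of_nonneg_right (by linarith) (norm_nonneg _))

/-- A `C^{q,β}` function on an open set with compact support inside it is of class `C^{q,β}_0`. -/
theorem HolderBound.inHolderZero {E : Type} [NormedAddCommGroup E] [NormedSpace ℝ E]
    [FiniteDimensional ℝ E] {q : ℕ} {β : ℝ≥0} {Ω : Set E} {w : E → ℝ} {M : ℝ} (hΩ : IsOpen Ω)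
    (h : HolderBound q β Ω w M) (hc : HasCompactSupport w) (hw : tsupport w ⊆ Ω) :
    InHolderZero q β Ω w := by
  have hcd : ContDiff ℝ q w := contDiff_of_contDiffAt_tsupport fun x hx =>
    h.contDiffOn.contDiffAt (hΩ.mem_nhds (hw hx))
  exact ⟨⟨h.contDiffOn, hcd.continuous.continuousOn, fun j hj => ⟨iteratedFDeriv ℝ j w,
    (hcd.continuous_iteratedFDeriv (by exact_mod_cast hj)).continuousOn, fun x _ => rfl⟩,
    h.holderNorm_le.trans_lt ENNReal.ofReal_lt_top⟩, hc, hw⟩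

theorem mainTheorem12 (α : ℝ≥0) (hα0 : 0 < α) (hα1 : α < 1)
    (Ω₀ : Set E3) (hΩ₀ : IsHolderDomain 4 α Ω₀)
    (z : E3) (r : ℝ) (hr : 0 < r) (hB : closedBall z r ⊆ Ω₀)
    (K : ℝ≥0) (δ : ℝ) (hδ : 0 < δ) (q : ℕ) :
    ∃ C : ℝ≥0, 0 < C ∧
      ∀ R : ℝ, thickening δ (basicDesign Ω₀ z r) ⊆ ball z R →
      ∀ β : ℝ≥0, β ≤ 1 → 1 ≤ (q : ℝ) + β → (q : ℝ) + β ≤ 4 + α →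
      ∀ Ω ∈ admissibleShapes 4 α K (basicDesign Ω₀ z r) (ball z R),
      ∀ v : E3 → ℝ, InHolder q β Ω v →
        ∃ w : E3 → ℝ, InHolderZero q β (ball z R) w ∧ EqOn w v (closure Ω) ∧
          holderNorm q β (ball z R) w ≤ C * holderNorm q β Ω v := by
  set D := basicDesign Ω₀ z r with hDdef
  have hα1' : (α : ℝ) < 1 := by exact_mod_cast hα1
  have hDo : IsOpen D := isOpen_basicDesign hΩ₀.isOpen
  have hDb : Bornology.IsBounded D := hΩ₀.isBounded.subset sdiff_subset
  obtain ⟨c, hc⟩ := exists_tameOn_comp q (K := K) α.coe_nonneg hα1'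
  obtain ⟨C₀, hC₀, hext⟩ := exists_extension_of_locallyExtendable q α c hDb.isCompact_closure
    (fun p hp => locallyExtendable_basicDesign q hα1 hr hΩ₀ hB c hp) (half_pos hδ)
  obtain ⟨C₁, hC₁, hcomp⟩ :=
    HolderBound.exists_comp (E := E3) (F := E3) (G := ℝ) q (2 ^ 5 * K)
  -- The norm has `q + 1` suprema and one seminorm, whence `q + 2`; the summand 1 only ensures
  -- positivity.
  set C : ℝ := (q + 2) * (C₁ * C₀) + 1 with hC
  have hCpos : 0 < C := by positivity
  refine ⟨C.toNNReal, Real.toNNReal_pos.2 hCpos, ?_⟩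
  rintro R hR β hβ1 - hq _ ⟨Φ, ⟨hbij, hΦ, hΦK, Ψ, hinv, hΨ, hΨK⟩, rfl⟩ v hv
  have hβ1' : (β : ℝ) ≤ 1 := by exact_mod_cast hβ1
  have hDR : D ⊆ ball z R := (self_subset_thickening hδ _).trans hR
  have hΦb : HolderBound 4 α (ball z R) Φ K := (hΦ.holderBound isBounded_ball).mono subset_rfl
    (ENNReal.toReal_le_of_le_ofReal K.coe_nonneg (by simpa using hΦK))
  have hΨb : HolderBound 4 α (ball z R) Ψ K := (hΨ.holderBound isBounded_ball).mono subset_rfl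
    (ENNReal.toReal_le_of_le_ofReal K.coe_nonneg (by simpa using hΨK))
  have hΨm : MapsTo Ψ (closure (ball z R)) (closure (ball z R)) := fun y hy => by
    obtain ⟨x, hx, rfl⟩ := hbij.surjOn hy
    rwa [hinv.1 hx]
  have hΦB : MapsTo Φ (ball z R) (ball z R) :=
    mapsTo_ball_of_leftInvOn hΦb hΨb hΨ.continuousOn hbij.mapsTo hinv.1
  have hΨB : MapsTo Ψ (ball z R) (ball z R) :=
    mapsTo_ball_of_leftInvOn hΨb hΦb hΦ.continuousOn hΨm hinv.2
  have hΨΦ : ∀ x ∈ ball z R, Ψ (Φ x) = x := fun x hx => hinv.1 (subset_closure hx)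
  have hΦΨ : ∀ x ∈ ball z R, Φ (Ψ x) = x := fun x hx => hinv.2 (subset_closure hx)
  have hΩR : Φ '' D ⊆ ball z R := (hΦB.mono_left hDR).image_subset
  have hΩo : IsOpen (Φ '' D) := by
    have : Φ '' D = ball z R ∩ Ψ ⁻¹' D := by
      ext y
      constructor
      · rintro ⟨x, hx, rfl⟩
        exact ⟨hΦB (hDR hx), by rwa [mem_preimage, hΨΦ x (hDR hx)]⟩
      · rintro ⟨hy, hy'⟩
        exact ⟨Ψ y, hy', hΦΨ y hy⟩
    rw [this]
    exact hΨb.contDiffOn.continuousOn.isOpen_inter_preimage isOpen_ball hDo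
  set M := (holderNorm q β (Φ '' D) v).toReal with hM
  have hvb : HolderBound q β (Φ '' D) v M := hv.holderBound (isBounded_ball.subset hΩR)
  obtain ⟨w₀, hw₀, hw₀u, hw₀s⟩ := hext β (v ∘ Φ) M β.coe_nonneg hβ1' hq
    (hc β (ball z R) D (Φ '' D) Φ v M β.coe_nonneg hβ1' hq isOpen_ball hΩo hDR
      (mapsTo_image _ _) hΦb hvb)
  have hwb : HolderBound q β (ball z R) (w₀ ∘ Ψ) (C₁ * (C₀ * M)) :=
    hcomp β univ (ball z R) w₀ Ψ _ β.coe_nonneg hβ1' isOpen_univ isOpen_ball (convex_ball _ _)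
      (mapsTo_univ _ _) hw₀ (hΨb.lower_of_le isOpen_ball (convex_ball _ _) β.coe_nonneg hβ1' hα1'
        (by exact_mod_cast hq)) fun x hx y hy =>
        (hΨb.lipschitz isOpen_ball (convex_ball _ _) x hx y hy).trans
          (by gcongr; linarith [K.coe_nonneg])
  -- Nothing is known about `Ψ` outside the closed ball, so the zero extension is imposed by hand.
  set w : E3 → ℝ := (ball z R).indicator (w₀ ∘ Ψ) with hw
  have hwb' : HolderBound q β (ball z R) w (C₁ * (C₀ * M)) :=
    hwb.congr isOpen_ball fun x hx => indicator_of_mem hx _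
  -- The margin enters here: the closed `δ/2`-thickening is compact and fits in the open
  -- `δ`-thickening.
  have hTR : cthickening (δ / 2) D ⊆ ball z R :=
    (cthickening_subset_thickening' hδ (by linarith) D).trans hR
  have hTc : IsCompact (Φ '' cthickening (δ / 2) D) :=
    (isCompact_of_isClosed_isBounded isClosed_cthickening hDb.cthickening).image_of_continuousOn
      (hΦb.contDiffOn.continuousOn.mono hTR)
  have hsupp : tsupport w ⊆ Φ '' cthickening (δ / 2) D := by
    refine closure_minimal (fun y hy => ?_) hTc.isClosed
    have hyB : y ∈ ball z R := by_contra fun h => hy (indicator_of_notMem h _)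
    refine ⟨Ψ y, hw₀s (subset_tsupport _ fun h0 => hy ?_), hΦΨ y hyB⟩
    rw [hw, indicator_of_mem hyB]
    exact h0
  have hsuppR : tsupport w ⊆ ball z R := hsupp.trans (hΦB.mono_left hTR).image_subset
  have hw0 : InHolderZero q β (ball z R) w := hwb'.inHolderZero isOpen_ball
    (hTc.of_isClosed_subset (isClosed_tsupport w) hsupp) hsuppR
  refine ⟨w, hw0, ?_, ?_⟩
  · refine EqOn.of_subset_closure (s := Φ '' D) ?_
      (hw0.inHolder.continuousOn.mono (closure_mono hΩR)) hv.continuousOn subset_closure subset_rfl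
    rintro _ ⟨x, hx, rfl⟩
    rw [hw, indicator_of_mem (hΦB (hDR hx)), Function.comp_apply, hΨΦ x (hDR hx), hw₀u hx]
    rfl
  · refine hwb'.holderNorm_le.trans ?_
    rw [← ENNReal.ofReal_toReal hv.norm_lt_top.ne, ← hM]
    change _ ≤ ENNReal.ofReal C * _
    rw [← ENNReal.ofReal_mul hCpos.le]
    refine ENNReal.ofReal_le_ofReal ?_
    have := hvb.nonneg
    rw [hC]
    linarith
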